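/- **Definitions.** A *cylinder category* is a category $\mathcal C$ with two classes of morphisms, the cofibrations ($\hookrightarrow$) and the weak equivalences (a *trivial cofibration* is a morphism in both classes), such that: both classes contain all isomorphisms and are closed under composition; the weak equivalences satisfy 2-out-of-6; $\mathcal C$ has an initial object $0$ and every $0\to X$ is a cofibration; pushouts of cofibrations along arbitrary maps exist and are cofibrations, and pushouts of trivial cofibrations are trivial cofibrations; every codiagonal $X\amalg X\to X$ factors as a cofibration followed by a weak equivalence; every trivial cofibration has a retraction. A *morphism* of cylinder categories is a functor preserving weak equivalences, cofibrations, the initial object and pushouts along cofibrations. For a cofibration $i:A\hookrightarrow B$, a relative cylinder object $I_AB$ is a factorization $B\amalg_A B\hookrightarrow I_AB\xrightarrow{\sim}B$ of the codiagonal. Maps $f,g:B\to X$ with $fi=gi$ are *homotopic relative to $A$* ($f\sim_A g$) if $(f,g):B\amalg_A B\to X$ extends to some relative cylinder object. A morphism $F:\mathcal C\to\mathcal D$ is *homotopy surjective* if every object $D$ of $\mathcal D$ admits a weak equivalence $D\to F(C)$; it is *homotopy fully faithful* if for every cofibration $i:A\hookrightarrow B$ and map $x:A\to X$ in $\mathcal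 C$ and every $v:F(B)\to F(X)$ with $v\circ F(i)=F(x)$ there is $v':B\to X$ with $v'i=x$ and $F(v')\sim_{F(A)}v$; it is *acyclic* if it is both. For $\mathcal C$ small, $\widetilde{\mathcal C}$ is the category of presheaves of sets on $\mathcal C$ sending the initial object to a singleton and pushouts along cofibrations to pullbacks; $\mathcal C$ is identified with the representable presheaves. In $\widetilde{\mathcal C}$, the cofibrations are the retracts of transfinite compositions of pushouts of cofibrations of $\mathcal C$; the fibrations are the maps with the right lifting property against the trivial cofibrations of $\mathcal C$; the trivial cofibrations are the maps with the left lifting property against the fibrations; and $f:X\to Y$ is a weak equivalence if for every cofibration $i:A\hookrightarrow B$ of $\mathcal C$, $x:A\to X$ and $v:B\to Y$ with $fx=vi$, there is $a:B\to X$ with $ai=x$ and $fa\sim_A v$ (homotopy through a relative cylinder object of $i$ in $\mathcal C$). For $X\in\widetilde{\mathcal C}$ and $x:A\to X$, put $$\pi_{B/A}(X,x)=\{f:B\to X\mid f\circ i=x\}/\sim_A .$$ For a morphism $F:\mathcal C\to\mathcal D$, let $R_F:\widetilde{\mathcal D}\to\widetilde{\mathcal C}$ be restriction along $F$ and $\widetilde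 F$ its left adjoint (the left Kan extension of $F$), which extends $F$. **Proposition.** Let $F:\mathcal C\to\mathcal D$ be a morphism of small cylinder categories. 1. For every object $Y$ of $\widetilde{\mathcal D}$, every cofibration $A\hookrightarrow B$ in $\mathcal C$ and every $y:F(A)\to Y$, the natural map $$\pi_{B/A}(R_F(Y),y)\to\pi_{F(B)/F(A)}(Y,y)$$ induced by the adjunction is a bijection. 2. If $F$ is homotopy fully faithful, then for every cofibrant object $X$ of $\widetilde{\mathcal C}$, every cofibration $A\hookrightarrow B$ in $\mathcal C$ and every $x:A\to X$, the natural map $$\pi_{B/A}(X,x)\to\pi_{F(B)/F(A)}(\widetilde F(X),\widetilde F(x))$$ induced by applying $\widetilde F$ is a bijection. 3. If $F$ is acyclic, then $(\widetilde F,R_F)$ is a Quillen equivalence for the above classes: $\widetilde F$ preserves cofibrations and trivial cofibrations, $R_F$ preserves fibrations and those fibrations that are weak equivalences, and for $X\in\widetilde{\mathcal C}$ cofibrant and $Y\in\widetilde{\mathcal D}$ fibrant, a map $\widetilde F(X)\to Y$ is a weak equivalence if and only if its adjoint transpose $X\to R_F(Y)$ is. -/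

import Mathlib

open CategoryTheory Limits Opposite

universe v u

/-- A cylinder category: a category with two classes of morphisms, the cofibrations `cof` and the
weak equivalences `weq`. Trivial cofibrations are the morphisms that lie in both classes. -/
class CylinderCategory (C : Type u) [Category.{v} C] where
  cof : MorphismProperty C
  weq : MorphismProperty C
  cof_of_isIso : ∀ {X Y : C} (f : X ⟶ Y), IsIso f → cof f
  cof_comp : ∀ {X Y Z : C} (f : X ⟶ Y) (g : Y ⟶ Z), cof f → cof g → cof (f ≫ g)
  weq_of_isIso : ∀ {X Y : C} (f : X ⟶ Y), IsIso f → weq f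
  weq_comp : ∀ {X Y Z : C} (f : X ⟶ Y) (g : Y ⟶ Z), weq f → weq g → weq (f ≫ g)
  two_out_of_six : ∀ {X Y Z T : C} (f : X ⟶ Y) (g : Y ⟶ Z) (h : Z ⟶ T),
    weq (f ≫ g) → weq (g ≫ h) → weq f ∧ weq g ∧ weq h ∧ weq (f ≫ g ≫ h)
  hasInitial : HasInitial C
  cof_of_isInitial : ∀ {Z X : C} (hZ : IsInitial Z), cof (hZ.to X)
  hasPushout : ∀ {A B A' : C} (i : A ⟶ B) (f : A ⟶ A'), cof i → HasPushout i f
  cof_of_isPushout : ∀ {A B A' B' : C} {i : A ⟶ B} {f : A ⟶ A'} {g : B ⟶ B'} {i' : A' ⟶ B'},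
    IsPushout i f g i' → cof i → cof i'
  trivCof_of_isPushout : ∀ {A B A' B' : C} {i : A ⟶ B} {f : A ⟶ A'} {g : B ⟶ B'} {i' : A' ⟶ B'},
    IsPushout i f g i' → cof i → weq i → cof i' ∧ weq i'
  exists_cylinder : ∀ X : C, ∃ (P : C) (inl inr : X ⟶ P) (I : C) (j : P ⟶ I) (p : I ⟶ X),
    Nonempty (IsColimit (BinaryCofan.mk inl inr)) ∧ cof j ∧ weq p ∧
      inl ≫ j ≫ p = 𝟙 X ∧ inr ≫ j ≫ p = 𝟙 X
  exists_retraction : ∀ {A B : C} (i : A ⟶ B), cof i → weq i → ∃ r : B ⟶ A, i ≫ r = 𝟙 A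

namespace CylinderCategory

/-- A morphism of cylinder categories. -/
structure IsMorphism {C : Type*} [Category* C] [CylinderCategory C]
    {D : Type*} [Category* D] [CylinderCategory D] (F : C ⥤ D) : Prop where
  map_weq : ∀ {X Y : C} (f : X ⟶ Y), weq f → weq (F.map f)
  map_cof : ∀ {X Y : C} (f : X ⟶ Y), cof f → cof (F.map f)
  map_initial : ∀ {Z : C}, IsInitial Z → Nonempty (IsInitial (F.obj Z))
  map_isPushout : ∀ {A B A' B' : C} {i : A ⟶ B} {f : A ⟶ A'} {g : B ⟶ B'} {i' : A' ⟶ B'},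
    cof i → IsPushout i f g i' → IsPushout (F.map i) (F.map f) (F.map g) (F.map i')

/-- A relative cylinder object for `i : A ⟶ B`: a factorization of the codiagonal
`B ⨿_A B ⟶ B` as a cofibration `j` followed by a weak equivalence `p`. -/
structure RelCylinder {C : Type*} [Category* C] [CylinderCategory C] {A B : C} (i : A ⟶ B) where
  double : C
  inl : B ⟶ double
  inr : B ⟶ double
  isPushout : IsPushout i i inl inr
  cyl : C
  j : double ⟶ cyl
  p : cyl ⟶ B
  cof_j : cof j
  weq_p : weq p
  inl_j_p : inl ≫ j ≫ p = 𝟙 B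
  inr_j_p : inr ≫ j ≫ p = 𝟙 B

/-- `f ∼_A g`: the map `(f, g) : B ⨿_A B ⟶ X` extends to some relative cylinder object. -/
def Homotopic {C : Type*} [Category* C] [CylinderCategory C] {A B X : C} (i : A ⟶ B)
    (f g : B ⟶ X) : Prop :=
  ∃ (K : RelCylinder i) (h : K.cyl ⟶ X), K.inl ≫ K.j ≫ h = f ∧ K.inr ≫ K.j ≫ h = g

def HomotopySurjective {C : Type*} [Category* C] {D : Type*} [Category* D] [CylinderCategory D]
    (F : C ⥤ D) : Prop :=
  ∀ Y : D, ∃ (X : C) (f : Y ⟶ F.obj X), weq f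

def HomotopyFullyFaithful {C : Type*} [Category* C] [CylinderCategory C]
    {D : Type*} [Category* D] [CylinderCategory D] (F : C ⥤ D) : Prop :=
  ∀ {A B X : C} (i : A ⟶ B) (x : A ⟶ X) (v : F.obj B ⟶ F.obj X), cof i →
    F.map i ≫ v = F.map x →
      ∃ v' : B ⟶ X, i ≫ v' = x ∧ Homotopic (F.map i) (F.map v') v

def Acyclic {C : Type*} [Category* C] [CylinderCategory C]
    {D : Type*} [Category* D] [CylinderCategory D] (F : C ⥤ D) : Prop :=
  HomotopySurjective F ∧ HomotopyFullyFaithful F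

section Completion

/-- The presheaves that send the initial object to a singleton and pushouts along cofibrations to
pullbacks. -/
def isContinuous (C : Type u) [SmallCategory C] [CylinderCategory C] :
    ObjectProperty (Cᵒᵖ ⥤ Type u) := fun P =>
  (∀ Z : C, IsInitial Z → Nonempty (Unique (P.obj (op Z)))) ∧
  ∀ {A B A' B' : C} (i : A ⟶ B) (f : A ⟶ A') (g : B ⟶ B') (i' : A' ⟶ B'), cof i →
    IsPushout i f g i' → IsPullback (P.map g.op) (P.map i'.op) (P.map i.op) (P.map f.op)

/-- The completion `C̃` of a small cylinder category. -/
abbrev Completion (C : Type u) [SmallCategory C] [CylinderCategory C] : Type (u + 1) :=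
  (isContinuous C).FullSubcategory

variable {C : Type u} [SmallCategory C] [CylinderCategory C]
variable {D : Type u} [SmallCategory D] [CylinderCategory D]

lemma isContinuous_yoneda (X : C) : isContinuous C (yoneda.obj X) := by
  refine ⟨fun Z hZ => ⟨⟨⟨hZ.to X⟩, fun f => hZ.hom_ext _ _⟩⟩, ?_⟩
  intro A B A' B' i f g i' _ sq
  exact (sq.op.map (yoneda.obj X)).flip

variable (C) in
/-- The Yoneda embedding `C ⥤ C̃`. -/
def yo : C ⥤ Completion C := (isContinuous C).lift yoneda isContinuous_yoneda

lemma IsMorphism.isContinuous_comp {F : C ⥤ D} (hF : IsMorphism F) {P : Dᵒᵖ ⥤ Type u}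
    (hP : isContinuous D P) : isContinuous C (F.op ⋙ P) := by
  refine ⟨fun Z hZ => hP.1 _ (hF.map_initial hZ).some, ?_⟩
  intro A B A' B' i f g i' hi sq
  exact hP.2 _ _ _ _ (hF.map_cof i hi) (hF.map_isPushout hi sq)

/-- The restriction functor `R_F : D̃ ⥤ C̃`. -/
def restr {F : C ⥤ D} (hF : IsMorphism F) : Completion D ⥤ Completion C :=
  (isContinuous C).lift ((isContinuous D).ι ⋙ (Functor.whiskeringLeft _ _ _).obj F.op)
    (fun P => hF.isContinuous_comp P.property)

section Reflection

variable (C) in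
/-- The pushout squares along a cofibration. -/
structure CofSquare where
  {A B A' B' : C}
  {i : A ⟶ B}
  {f : A ⟶ A'}
  {g : B ⟶ B'}
  {i' : A' ⟶ B'}
  cof_i : cof i
  sq : IsPushout i f g i'

/-- The comparison morphism in presheaves from the pushout of representables. -/
noncomputable def CofSquare.hom (s : CofSquare C) :
    pushout (yoneda.map s.i) (yoneda.map s.f) ⟶ yoneda.obj s.B' :=
  pushout.desc (yoneda.map s.g) (yoneda.map s.i') (by
    rw [← Functor.map_comp, ← Functor.map_comp, s.sq.w])

@[simp]
lemma CofSquare.inl_hom {P : Cᵒᵖ ⥤ Type u} (s : CofSquare C) (q : yoneda.obj s.B' ⟶ P) :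
    pushout.inl (yoneda.map s.i) (yoneda.map s.f) ≫ s.hom ≫ q = yoneda.map s.g ≫ q := by
  rw [← Category.assoc, CofSquare.hom, pushout.inl_desc]

@[simp]
lemma CofSquare.inr_hom {P : Cᵒᵖ ⥤ Type u} (s : CofSquare C) (q : yoneda.obj s.B' ⟶ P) :
    pushout.inr (yoneda.map s.i) (yoneda.map s.f) ≫ s.hom ≫ q = yoneda.map s.i' ≫ q := by
  rw [← Category.assoc, CofSquare.hom, pushout.inr_desc]

variable (C) in
abbrev LocIndex : Type u := {Z : C // Nonempty (IsInitial Z)} ⊕ CofSquare C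

noncomputable def locSrc : LocIndex C → (Cᵒᵖ ⥤ Type u)
  | .inl _ => ⊥_ _
  | .inr s => pushout (yoneda.map s.i) (yoneda.map s.f)

def locTgt : LocIndex C → (Cᵒᵖ ⥤ Type u)
  | .inl Z => yoneda.obj Z.1
  | .inr s => yoneda.obj s.B'

noncomputable def locHom : ∀ k : LocIndex C, locSrc k ⟶ locTgt k
  | .inl Z => initial.to (yoneda.obj Z.1)
  | .inr s => s.hom

lemma bijective_initial_iff {E : Type u} [SmallCategory E] (P : Eᵒᵖ ⥤ Type u) (Z : E) :
    Function.Bijective (fun g : yoneda.obj Z ⟶ P => initial.to (yoneda.obj Z) ≫ g) ↔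
      Nonempty (Unique (P.obj (op Z))) := by
  constructor
  · intro h
    have e := (Equiv.ofBijective _ h).symm.trans yonedaEquiv
    exact ⟨e.symm.unique⟩
  · rintro ⟨h⟩
    refine ⟨fun a b _ => yonedaEquiv.injective (Subsingleton.elim _ _),
      fun b => ⟨yonedaEquiv.symm default, Subsingleton.elim _ _⟩⟩

lemma bijective_pushout_iff (P : Cᵒᵖ ⥤ Type u) (s : CofSquare C) :
    Function.Bijective (fun g : yoneda.obj s.B' ⟶ P => s.hom ≫ g) ↔
      IsPullback (P.map s.g.op) (P.map s.i'.op) (P.map s.i.op) (P.map s.f.op) := by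
  have w : s.i ≫ s.g = s.f ≫ s.i' := s.sq.w
  have nat : ∀ {X Y : C} (m : X ⟶ Y) (q : yoneda.obj Y ⟶ P),
      yonedaEquiv (yoneda.map m ≫ q) = P.map m.op (yonedaEquiv q) :=
    fun m q => (yonedaEquiv_naturality q m).symm
  rw [Types.isPullback_iff]
  constructor
  · rintro ⟨h1, h2⟩
    refine ⟨by rw [← P.map_comp, ← P.map_comp, ← op_comp, ← op_comp, w], ?_, ?_⟩
    · intro a b hab
      obtain ⟨a, rfl⟩ := yonedaEquiv.surjective a
      obtain ⟨b, rfl⟩ := yonedaEquiv.surjective b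
      simp only [← nat, EmbeddingLike.apply_eq_iff_eq] at hab
      congr 1
      apply h1
      apply pushout.hom_ext
      · simpa using hab.1
      · simpa using hab.2
    · intro b a hab
      obtain ⟨a, rfl⟩ := yonedaEquiv.surjective a
      obtain ⟨b, rfl⟩ := yonedaEquiv.surjective b
      simp only [← nat, EmbeddingLike.apply_eq_iff_eq] at hab
      obtain ⟨t, ht⟩ := h2 (pushout.desc b a hab)
      dsimp only at ht
      refine ⟨yonedaEquiv t, ?_, ?_⟩
      · rw [← nat, ← s.inl_hom, ht, pushout.inl_desc]
      · rw [← nat, ← s.inr_hom, ht, pushout.inr_desc]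
  · rintro ⟨-, h1, h2⟩
    constructor
    · intro a b hab
      dsimp only at hab
      apply yonedaEquiv.injective
      apply h1
      rw [← nat, ← nat, ← nat, ← nat, ← s.inl_hom, ← s.inr_hom, hab, s.inl_hom, s.inr_hom]
      exact ⟨rfl, rfl⟩
    · intro q
      obtain ⟨t, ht⟩ := h2 (yonedaEquiv (pushout.inl _ _ ≫ q))
        (yonedaEquiv (pushout.inr _ _ ≫ q)) (by
          rw [← nat, ← nat, pushout.condition_assoc])
      obtain ⟨t, rfl⟩ := yonedaEquiv.surjective t
      simp only [← nat, EmbeddingLike.apply_eq_iff_eq] at ht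
      refine ⟨t, ?_⟩
      apply pushout.hom_ext
      · simpa using ht.1
      · simpa using ht.2

lemma isContinuous_eq_isLocal :
    isContinuous C = (MorphismProperty.ofHoms (locHom (C := C))).isLocal := by
  ext P
  constructor
  · rintro ⟨h1, h2⟩ X Y f ⟨k⟩
    rcases k with Z | s
    · exact (bijective_initial_iff P Z.1).2 (h1 _ Z.2.some)
    · exact (bijective_pushout_iff P s).2 (h2 _ _ _ _ s.cof_i s.sq)
  · intro h
    refine ⟨fun Z hZ => (bijective_initial_iff P Z).1 (h _ ⟨(Sum.inl ⟨Z, ⟨hZ⟩⟩ : LocIndex C)⟩), ?_⟩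
    intro A B A' B' i f g i' hi sq
    exact (bijective_pushout_iff P ⟨hi, sq⟩).1 (h _ ⟨(Sum.inr ⟨hi, sq⟩ : LocIndex C)⟩)

lemma isCardinalPresentable_yoneda {E : Type u} [SmallCategory E]
    (κ : Cardinal.{u}) [Fact κ.IsRegular] (X : E) :
    IsCardinalPresentable (yoneda.obj X) κ where
  preservesColimitOfShape J _ _ :=
    preservesColimitsOfShape_of_natIso
      (NatIso.ofComponents (fun P => Equiv.toIso (yonedaEquiv (F := P)).symm)
        (by
          intro P Q f
          refine ConcreteCategory.hom_ext _ _ fun x => ?_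
          exact (yonedaEquiv_symm_naturality_right X f x).symm) :
        (evaluation Eᵒᵖ (Type u)).obj (op X) ≅ coyoneda.obj (op (yoneda.obj X)))

lemma isRightAdjoint_isContinuous_ι : (isContinuous C).ι.IsRightAdjoint := by
  rw [isContinuous_eq_isLocal]
  have : Fact (Cardinal.aleph0.{u}).IsRegular := ⟨Cardinal.isRegular_aleph0⟩
  apply MorphismProperty.isRightAdjoint_ι_isLocal _ Cardinal.aleph0.{u}
  rintro X Y f ⟨k⟩
  have hy := isCardinalPresentable_yoneda (E := C) Cardinal.aleph0.{u}
  rcases k with Z | s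
  · refine ⟨?_, hy _⟩
    have : ∀ k, IsCardinalPresentable ((Functor.empty (Cᵒᵖ ⥤ Type u)).obj k)
      Cardinal.aleph0.{u} := by rintro ⟨⟨⟩⟩
    exact isCardinalPresentable_of_isColimit _ initialIsInitial Cardinal.aleph0.{u}
      ((hasCardinalLT_aleph0_iff _).2 inferInstance)
  · refine ⟨?_, hy _⟩
    have : ∀ k, IsCardinalPresentable ((span (yoneda.map s.i) (yoneda.map s.f)).obj k)
        Cardinal.aleph0.{u} := by
      rintro (_ | _ | _)
      all_goals exact hy _
    exact isCardinalPresentable_of_isColimit _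
      (colimit.isColimit (span (yoneda.map s.i) (yoneda.map s.f)))
      Cardinal.aleph0.{u}
      ((hasCardinalLT_aleph0_iff _).2 inferInstance)

end Reflection

/-- The reflection of presheaves onto the completion. -/
noncomputable def reflector (C : Type u) [SmallCategory C] [CylinderCategory C] :
    (Cᵒᵖ ⥤ Type u) ⥤ Completion C :=
  have := isRightAdjoint_isContinuous_ι (C := C)
  (isContinuous C).ι.leftAdjoint

noncomputable def reflectorAdj (C : Type u) [SmallCategory C] [CylinderCategory C] :
    reflector C ⊣ (isContinuous C).ι :=
  have := isRightAdjoint_isContinuous_ι (C := C)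
  Adjunction.ofIsRightAdjoint _

/-- The functor `F̃ : C̃ ⥤ D̃`: left Kan extension of presheaves along `F`, reflected into `D̃`. -/
noncomputable def lanExt (F : C ⥤ D) : Completion C ⥤ Completion D :=
  (isContinuous C).ι ⋙ F.op.lan ⋙ reflector D

/-- `F̃` is left adjoint to `R_F`. -/
noncomputable def lanExtAdj {F : C ⥤ D} (hF : IsMorphism F) : lanExt F ⊣ restr hF :=
  ((F.op.lanAdjunction (Type u)).comp (reflectorAdj D)).restrictFullyFaithful
    (isContinuous C).fullyFaithfulι (Functor.FullyFaithful.id _) (Iso.refl _) (Iso.refl _)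

/-- The Yoneda lemma in the completion. -/
def elt (B : C) (X : Completion C) : ((yo C).obj B ⟶ X) ≃ X.obj.obj (op B) :=
  (isContinuous C).fullyFaithfulι.homEquiv.trans yonedaEquiv

lemma elt_comp {B : C} {X Y : Completion C} (f : (yo C).obj B ⟶ X) (g : X ⟶ Y) :
    elt B Y (f ≫ g) = g.hom.app (op B) (elt B X f) :=
  yonedaEquiv_comp (F := X.obj) (G := Y.obj) f.hom g.hom

lemma elt_map_comp {A B : C} {X : Completion C} (i : A ⟶ B) (f : (yo C).obj B ⟶ X) :
    elt A X ((yo C).map i ≫ f) = X.obj.map i.op (elt B X f) :=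
  (yonedaEquiv_naturality (F := X.obj) f.hom i).symm

/-- The Yoneda transposition: morphisms `B ⟶ R_F Y` in `C̃` correspond to morphisms `F B ⟶ Y`
in `D̃`, both being the elements of `(R_F Y) B = Y (F B)`. -/
def transpose {F : C ⥤ D} (hF : IsMorphism F) {B : C} {Y : Completion D} :
    ((yo C).obj B ⟶ (restr hF).obj Y) ≃ ((yo D).obj (F.obj B) ⟶ Y) :=
  (elt B ((restr hF).obj Y)).trans (elt (F.obj B) Y).symm

lemma elt_transpose {F : C ⥤ D} (hF : IsMorphism F) {B : C} {Y : Completion D}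
    (f : (yo C).obj B ⟶ (restr hF).obj Y) :
    elt (F.obj B) Y (transpose hF f) = elt B ((restr hF).obj Y) f :=
  (elt (F.obj B) Y).apply_symm_apply _

lemma transpose_comp {F : C ⥤ D} (hF : IsMorphism F) {B : C} {Y Y' : Completion D}
    (f : (yo C).obj B ⟶ (restr hF).obj Y) (g : Y ⟶ Y') :
    transpose hF (f ≫ (restr hF).map g) = transpose hF f ≫ g := by
  apply (elt _ _).injective
  rw [elt_comp, elt_transpose, elt_transpose, elt_comp]
  rfl

lemma map_comp_transpose {F : C ⥤ D} (hF : IsMorphism F) {A B : C} {Y : Completion D}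
    (i : A ⟶ B) (f : (yo C).obj B ⟶ (restr hF).obj Y) :
    transpose hF ((yo C).map i ≫ f) = (yo D).map (F.map i) ≫ transpose hF f := by
  apply (elt _ _).injective
  rw [elt_map_comp, elt_transpose, elt_transpose, elt_map_comp]
  rfl

/-- `F̃` extends `F` along the Yoneda embeddings. -/
noncomputable def lanExtYo {F : C ⥤ D} (hF : IsMorphism F) : F ⋙ yo D ≅ yo C ⋙ lanExt F :=
  NatIso.ofComponents
    (fun B =>
      { hom := transpose hF ((lanExtAdj hF).unit.app ((yo C).obj B))
        inv := ((lanExtAdj hF).homEquiv _ _).symm ((transpose hF).symm (𝟙 _))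
        hom_inv_id := by
          rw [← transpose_comp, ← Adjunction.homEquiv_unit, Equiv.apply_symm_apply,
            Equiv.apply_symm_apply]
          rfl
        inv_hom_id := by
          apply ((lanExtAdj hF).homEquiv _ _).injective
          rw [Adjunction.homEquiv_naturality_right, Equiv.apply_symm_apply,
            Adjunction.homEquiv_unit]
          apply (transpose hF).injective
          rw [transpose_comp, Equiv.apply_symm_apply, Category.id_comp, transpose_comp]
          exact (Category.comp_id _).symm })
    (by
      intro A B i
      dsimp
      rw [← map_comp_transpose, ← transpose_comp]
      congr 1
      exact (lanExtAdj hF).unit.naturality ((yo C).map i))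

/-- `f ∼_A g` for morphisms `B ⟶ X` of the completion: the map `(f, g)` extends from `B ⨿_A B` to
some relative cylinder object of `i : A ⟶ B` in `C`. -/
def HomotopicRel {A B : C} (i : A ⟶ B) {X : Completion C} (f g : (yo C).obj B ⟶ X) : Prop :=
  ∃ (K : RelCylinder i) (h : (yo C).obj K.cyl ⟶ X),
    (yo C).map (K.inl ≫ K.j) ≫ h = f ∧ (yo C).map (K.inr ≫ K.j) ≫ h = g

/-- The set `π_{B/A}(X, x)`. -/
def PiSet {A B : C} (i : A ⟶ B) (X : Completion C) (x : (yo C).obj A ⟶ X) : Type u :=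
  Quot (fun f g : {f : (yo C).obj B ⟶ X // (yo C).map i ≫ f = x} => HomotopicRel i f.1 g.1)

/-- The image of a relative cylinder object under a morphism of cylinder categories. -/
def RelCylinder.map {F : C ⥤ D} (hF : IsMorphism F) {A B : C} {i : A ⟶ B} (hi : cof i)
    (K : RelCylinder i) : RelCylinder (F.map i) where
  double := F.obj K.double
  inl := F.map K.inl
  inr := F.map K.inr
  isPushout := hF.map_isPushout hi K.isPushout
  cyl := F.obj K.cyl
  j := F.map K.j
  p := F.map K.p
  cof_j := hF.map_cof _ K.cof_j
  weq_p := hF.map_weq _ K.weq_p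
  inl_j_p := by rw [← F.map_comp, ← F.map_comp, K.inl_j_p, F.map_id]
  inr_j_p := by rw [← F.map_comp, ← F.map_comp, K.inr_j_p, F.map_id]

lemma HomotopicRel.transpose {F : C ⥤ D} (hF : IsMorphism F) {A B : C} {i : A ⟶ B} (hi : cof i)
    {Y : Completion D} {f g : (yo C).obj B ⟶ (restr hF).obj Y} (hfg : HomotopicRel i f g) :
    HomotopicRel (F.map i) (transpose hF f) (transpose hF g) := by
  obtain ⟨K, h, rfl, rfl⟩ := hfg
  refine ⟨K.map hF hi, CylinderCategory.transpose hF h, ?_, ?_⟩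
  all_goals
    rw [map_comp_transpose, F.map_comp]
    rfl

/-- The natural map `π_{B/A}(R_F Y, y) ⟶ π_{F B/F A}(Y, y)`, sending a morphism `B ⟶ R_F Y` to its
transpose `F B ⟶ Y`. -/
def piTranspose {F : C ⥤ D} (hF : IsMorphism F) {A B : C} (i : A ⟶ B) (hi : cof i)
    (Y : Completion D) (y : (yo D).obj (F.obj A) ⟶ Y) :
    PiSet i ((restr hF).obj Y) ((transpose hF).symm y) → PiSet (F.map i) Y y :=
  Quot.map
    (fun f => ⟨transpose hF f.1, by
      rw [← map_comp_transpose, f.2, Equiv.apply_symm_apply]⟩)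
    (fun _ _ h => h.transpose hF hi)

/-- The morphism `F B ≅ F̃ B ⟶ F̃ X` obtained by applying `F̃` to `f : B ⟶ X`. -/
noncomputable def applyExt {F : C ⥤ D} (hF : IsMorphism F) {B : C} {X : Completion C}
    (f : (yo C).obj B ⟶ X) : (yo D).obj (F.obj B) ⟶ (lanExt F).obj X :=
  (lanExtYo hF).hom.app B ≫ (lanExt F).map f

lemma applyExt_map_comp {F : C ⥤ D} (hF : IsMorphism F) {A B : C} {X : Completion C} (i : A ⟶ B)
    (f : (yo C).obj B ⟶ X) :
    applyExt hF ((yo C).map i ≫ f) = (yo D).map (F.map i) ≫ applyExt hF f := by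
  have := (lanExtYo hF).hom.naturality i
  dsimp only [Functor.comp_obj, Functor.comp_map] at this
  rw [applyExt, applyExt, Functor.map_comp, reassoc_of% this]

lemma HomotopicRel.applyExt {F : C ⥤ D} (hF : IsMorphism F) {A B : C} {i : A ⟶ B} (hi : cof i)
    {X : Completion C} {f g : (yo C).obj B ⟶ X} (hfg : HomotopicRel i f g) :
    HomotopicRel (F.map i) (applyExt hF f) (applyExt hF g) := by
  obtain ⟨K, h, rfl, rfl⟩ := hfg
  refine ⟨K.map hF hi, CylinderCategory.applyExt hF h, ?_, ?_⟩
  all_goals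
    rw [applyExt_map_comp, F.map_comp]
    rfl

/-- The natural map `π_{B/A}(X, x) ⟶ π_{F B/F A}(F̃ X, F̃ x)` induced by applying `F̃`. -/
noncomputable def piExt {F : C ⥤ D} (hF : IsMorphism F) {A B : C} (i : A ⟶ B) (hi : cof i)
    (X : Completion C) (x : (yo C).obj A ⟶ X) :
    PiSet i X x → PiSet (F.map i) ((lanExt F).obj X) (applyExt hF x) :=
  Quot.map
    (fun f => ⟨applyExt hF f.1, by rw [← applyExt_map_comp, f.2]⟩)
    (fun _ _ h => h.applyExt hF hi)

end Completion

/-- The three classes of morphisms of a (semi-)model category. -/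
structure ModelClasses (E : Type*) [Category* E] where
  cof : MorphismProperty E
  fib : MorphismProperty E
  weq : MorphismProperty E

namespace ModelClasses

def IsCofibrant {E : Type*} [Category* E] (M : ModelClasses E) (X : E) : Prop :=
  ∀ (Z : E) (hZ : IsInitial Z), M.cof (hZ.to X)

def IsFibrant {E : Type*} [Category* E] (M : ModelClasses E) (X : E) : Prop :=
  ∀ (T : E) (hT : IsTerminal T), M.fib (hT.from X)

/-- `L ⊣ R` is a Quillen pair: `L` preserves cofibrations and trivial cofibrations (the morphisms
with the left lifting property against all fibrations), and `R` preserves fibrations and trivial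
fibrations. -/
structure IsQuillenPair {E E' : Type*} [Category* E] [Category* E'] (M : ModelClasses E)
    (M' : ModelClasses E') (L : E ⥤ E') (R : E' ⥤ E) : Prop where
  map_cof : ∀ {X Y : E} (f : X ⟶ Y), M.cof f → M'.cof (L.map f)
  map_trivCof : ∀ {X Y : E} (f : X ⟶ Y), M.fib.llp f → M'.fib.llp (L.map f)
  map_fib : ∀ {X Y : E'} (f : X ⟶ Y), M'.fib f → M.fib (R.map f)
  map_trivFib : ∀ {X Y : E'} (f : X ⟶ Y), M'.fib f → M'.weq f →
    M.fib (R.map f) ∧ M.weq (R.map f)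

/-- A Quillen pair is a Quillen equivalence if, for `X` cofibrant and `Y` fibrant, a morphism
`L X ⟶ Y` is a weak equivalence if and only if its adjunct `X ⟶ R Y` is. -/
structure IsQuillenEquivalence {E E' : Type*} [Category* E] [Category* E'] (M : ModelClasses E)
    (M' : ModelClasses E') {L : E ⥤ E'} {R : E' ⥤ E} (adj : L ⊣ R) : Prop where
  isQuillenPair : IsQuillenPair M M' L R
  weq_iff : ∀ {X : E} {Y : E'} (w : L.obj X ⟶ Y), M.IsCofibrant X → M'.IsFibrant Y →
    (M'.weq w ↔ M.weq (adj.homEquiv X Y w))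

end ModelClasses

section CompletionClasses

variable (C : Type u) [SmallCategory C] [CylinderCategory C]

/-- The cofibrations of `C`, seen in the completion. -/
inductive genCof : MorphismProperty (Completion C)
  | mk {A B : C} (i : A ⟶ B) (hi : cof i) : genCof ((yo C).map i)

/-- The trivial cofibrations of `C`, seen in the completion. -/
inductive genTrivCof : MorphismProperty (Completion C)
  | mk {A B : C} (i : A ⟶ B) (hi : cof i) (hi' : weq i) : genTrivCof ((yo C).map i)

/-- Cellular maps: transfinite compositions of pushouts of cofibrations of `C`. -/
def cellular : MorphismProperty (Completion C) :=
  MorphismProperty.transfiniteCompositions.{u} (genCof C).pushouts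

/-- The weak equivalences of the completion: every square from a cofibration `i : A ⟶ B` of `C` to
`f` has a filler that makes the upper triangle commute and the lower one commute up to a homotopy
relative to `A`. -/
def completionWeq : MorphismProperty (Completion C) := fun X Y f =>
  ∀ {A B : C} (i : A ⟶ B) (x : (yo C).obj A ⟶ X) (v : (yo C).obj B ⟶ Y), cof i →
    x ≫ f = (yo C).map i ≫ v →
      ∃ a : (yo C).obj B ⟶ X, (yo C).map i ≫ a = x ∧ HomotopicRel i (a ≫ f) v

/-- The classes of morphisms of the completion: cofibrations are the retracts of cellular maps,
fibrations are the maps with the right lifting property against the trivial cofibrations of `C`. -/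
def completionClasses : ModelClasses (Completion C) where
  cof := (cellular C).retracts
  fib := (genTrivCof C).rlp
  weq := completionWeq C

end CompletionClasses

end CylinderCategory

/-! Trivial cofibrations of `C` split, so maps into any object of the completion extend along them.
Hence a homotopy can be moved to any chosen relative cylinder, and relative homotopy is an
equivalence relation.

For the first statement, a map `B ⟶ R_F Y` is the same as a map `F B ⟶ Y`, and `F` sends a cylinder
`K` of `i` to a cylinder of `F i`. Homotopies through `F K` are exactly the transposes of homotopies
through `K` (`homotopicRel_of_transpose`).

For the second, `UnitLifting` gives both halves: lifting against `i` yields surjectivity, lifting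
against the boundary inclusion of a cylinder yields injectivity. A cofibrant object is a retract of
a filtered colimit of objects of `C` (`exists_retract_isInd`). Maps out of objects of `C` and
equations between them live at one stage of such a colimit, where the lifting is homotopy full
faithfulness (`IsInd.unitLifting`).

For the third, the transpose of `w` is the unit followed by `R_F w`. The unit at a cofibrant object
is a weak equivalence by `UnitLifting`; since weak equivalences compose and can be cancelled on the
left, it remains that `R_F` preserves and reflects them. That `R_F f` is a weak equivalence means
that `f` has homotopy fillers against all `F i`. Having fillers depends only on the weak equivalence
class of the cofibration (`hasHomotopyFiller_of_weq`), and acyclicity connects every cofibration of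
`D` to some `F i'` (`weq_of_restr_map_weq`). -/

namespace CylinderCategory

/-! ### Factorizations and relative cylinders in a cylinder category -/

section Basic

variable {C : Type*} [Category* C] [CylinderCategory C]

lemma weq_of_comp_right {X Y Z : C} {f : X ⟶ Y} {g : Y ⟶ Z} (hg : weq g) (hfg : weq (f ≫ g)) :
    weq f :=
  (two_out_of_six f g (𝟙 Z) hfg (by simpa using hg)).1

lemma weq_of_comp_left {X Y Z : C} {f : X ⟶ Y} {g : Y ⟶ Z} (hf : weq f) (hfg : weq (f ≫ g)) :
    weq g :=
  (two_out_of_six (𝟙 X) f g (by simpa using hf) hfg).2.2.1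

lemma weq_id (X : C) : weq (𝟙 X) := weq_of_isIso _ inferInstance

/-- The trivial cofibrations. -/
def trivCof {X Y : C} (f : X ⟶ Y) : Prop := cof f ∧ weq f

lemma trivCof.comp {X Y Z : C} {f : X ⟶ Y} {g : Y ⟶ Z} (hf : trivCof f) (hg : trivCof g) :
    trivCof (f ≫ g) :=
  ⟨cof_comp _ _ hf.1 hg.1, weq_comp _ _ hf.2 hg.2⟩

lemma trivCof.of_isPushout {A B A' B' : C} {i : A ⟶ B} {f : A ⟶ A'} {g : B ⟶ B'} {i' : A' ⟶ B'}
    (sq : IsPushout i f g i') (hi : trivCof i) : trivCof i' :=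
  trivCof_of_isPushout sq hi.1 hi.2

lemma exists_isPushout {A B A' : C} (i : A ⟶ B) (f : A ⟶ A') (hi : cof i) :
    ∃ (P : C) (g : B ⟶ P) (i' : A' ⟶ P), IsPushout i f g i' ∧ cof i' := by
  have := hasPushout i f hi
  exact ⟨_, _, _, IsPushout.of_hasPushout i f,
    cof_of_isPushout (IsPushout.of_hasPushout i f) hi⟩

/-- The mapping cylinder factorization: every morphism is a cofibration followed by a weak
equivalence that is split by a trivial cofibration. -/
lemma exists_mappingCylinder {X Y : C} (f : X ⟶ Y) :
    ∃ (M : C) (c : X ⟶ M) (q : M ⟶ Y) (s : Y ⟶ M),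
      cof c ∧ weq q ∧ c ≫ q = f ∧ s ≫ q = 𝟙 Y ∧ trivCof s := by
  obtain ⟨P, inl, inr, I, j, p, ⟨hP⟩, hj, hp, hl, hr⟩ := exists_cylinder X
  have := hasInitial (C := C)
  have hPp : IsPushout (initial.to X) (initial.to X) inl inr :=
    (IsPushout.of_isColimit_binaryCofan_of_isInitial hP initialIsInitial).flip
  have cof0 : ∀ W : C, cof (initial.to W) := fun W => cof_of_isInitial initialIsInitial
  have cinr : cof inr := cof_of_isPushout hPp (cof0 X)
  -- `S` is `X ⨿ Y`, and `M` is the cylinder `I` with one end glued to `Y` along `f`.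
  obtain ⟨S, n, iY, sqS, -⟩ := exists_isPushout inr f cinr
  obtain ⟨M, g, m, sqM, cm⟩ := exists_isPushout j n hj
  have sq1 : IsPushout (inr ≫ j) f g (iY ≫ m) := sqS.flip.paste_vert sqM.flip |>.flip
  have hrj : trivCof (inr ≫ j) :=
    ⟨cof_comp _ _ cinr hj, weq_of_comp_right hp (by
      rw [Category.assoc, hr]; exact weq_id X)⟩
  have ts := trivCof.of_isPushout sq1 hrj
  have sq2 : IsPushout (initial.to X) (initial.to X ≫ f) (inl ≫ n) iY := hPp.paste_vert sqS
  have cn : cof (inl ≫ n) := cof_of_isPushout sq2.flip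
    (by convert cof0 Y using 1; exact initialIsInitial.hom_ext _ _)
  let q : M ⟶ Y := sq1.desc (p ≫ f) (𝟙 Y) (by
    rw [← Category.assoc, Category.assoc inr, hr]; simp)
  have hgq : g ≫ q = p ≫ f := sq1.inl_desc _ _ _
  have hsq : (iY ≫ m) ≫ q = 𝟙 Y := sq1.inr_desc _ _ _
  refine ⟨M, (inl ≫ n) ≫ m, q, iY ≫ m, cof_comp _ _ cn cm, ?_, ?_, hsq, ts⟩
  · exact weq_of_comp_left ts.2 (by rw [hsq]; exact weq_id Y)
  · rw [Category.assoc, Category.assoc, ← Category.assoc n, ← sqM.w, Category.assoc, hgq,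
      ← Category.assoc j, ← Category.assoc, hl, Category.id_comp]

lemma exists_factorization {X Y : C} (f : X ⟶ Y) :
    ∃ (M : C) (c : X ⟶ M) (q : M ⟶ Y), cof c ∧ weq q ∧ c ≫ q = f := by
  obtain ⟨M, c, q, -, hc, hq, h, -⟩ := exists_mappingCylinder f
  exact ⟨M, c, q, hc, hq, h⟩

lemma exists_relCylinder {A B : C} (i : A ⟶ B) (hi : cof i) : Nonempty (RelCylinder i) := by
  obtain ⟨P, l, r, sq, -⟩ := exists_isPushout i i hi
  obtain ⟨M, c, q, hc, hq, h⟩ := exists_factorization (sq.desc (𝟙 B) (𝟙 B) rfl)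
  exact ⟨⟨P, l, r, sq, M, c, q, hc, hq, by rw [h, sq.inl_desc], by rw [h, sq.inr_desc]⟩⟩

namespace RelCylinder

variable {A B : C} {i : A ⟶ B} (K : RelCylinder i)

/-- The first inclusion of the base into the cylinder. -/
def in₀ : B ⟶ K.cyl := K.inl ≫ K.j

/-- The second inclusion of the base into the cylinder. -/
def in₁ : B ⟶ K.cyl := K.inr ≫ K.j

lemma in₀_p : K.in₀ ≫ K.p = 𝟙 B := by rw [in₀, Category.assoc, K.inl_j_p]

lemma in₁_p : K.in₁ ≫ K.p = 𝟙 B := by rw [in₁, Category.assoc, K.inr_j_p]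

lemma comp_in₀ : i ≫ K.in₀ = i ≫ K.in₁ := by
  rw [in₀, in₁, ← Category.assoc, K.isPushout.w, Category.assoc]

lemma trivCof_in₀ (hi : cof i) : trivCof K.in₀ :=
  ⟨cof_comp _ _ (cof_of_isPushout K.isPushout.flip hi) K.cof_j,
    weq_of_comp_right K.weq_p (by rw [K.in₀_p]; exact weq_id B)⟩

lemma trivCof_in₁ (hi : cof i) : trivCof K.in₁ :=
  ⟨cof_comp _ _ (cof_of_isPushout K.isPushout hi) K.cof_j,
    weq_of_comp_right K.weq_p (by rw [K.in₁_p]; exact weq_id B)⟩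

lemma double_hom_ext {T : C} {f g : K.double ⟶ T} (h₀ : K.inl ≫ f = K.inl ≫ g)
    (h₁ : K.inr ≫ f = K.inr ≫ g) : f = g :=
  K.isPushout.hom_ext h₀ h₁

/-- Two relative cylinders over the same cofibration embed, relative to their bases, by trivial
cofibrations into a third object. -/
lemma exists_common (K' : RelCylinder i) :
    ∃ (L : C) (a : K.cyl ⟶ L) (b : K'.cyl ⟶ L), trivCof a ∧ trivCof b ∧
      K.in₀ ≫ a = K'.in₀ ≫ b ∧ K.in₁ ≫ a = K'.in₁ ≫ b := by
  let e : K.double ≅ K'.double := K.isPushout.isoIsPushout _ _ K'.isPushout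
  have e0 : K.inl ≫ e.hom = K'.inl := K.isPushout.inl_isoIsPushout_hom _ _ _
  have e1 : K.inr ≫ e.hom = K'.inr := K.isPushout.inr_isoIsPushout_hom _ _ _
  have ct : cof (e.hom ≫ K'.j) := cof_comp _ _ (cof_of_isIso _ inferInstance) K'.cof_j
  -- Glue the two cylinders along their common boundary, then factor the projection to `B`.
  -- Two-out-of-three over `B` makes both inclusions trivial.
  obtain ⟨P, a, b, sq, cb⟩ := exists_isPushout K.j (e.hom ≫ K'.j) K.cof_j
  have ca : cof a := cof_of_isPushout sq.flip ct
  obtain ⟨L, c, q, hc, hq, h⟩ := exists_factorization (sq.desc K.p K'.p (by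
    apply K.double_hom_ext
    · rw [K.inl_j_p, Category.assoc, reassoc_of% e0, K'.inl_j_p]
    · rw [K.inr_j_p, Category.assoc, reassoc_of% e1, K'.inr_j_p]))
  refine ⟨L, a ≫ c, b ≫ c, ⟨cof_comp _ _ ca hc, weq_of_comp_right hq ?_⟩,
    ⟨cof_comp _ _ cb hc, weq_of_comp_right hq ?_⟩, ?_, ?_⟩
  · rw [Category.assoc, h, sq.inl_desc]; exact K.weq_p
  · rw [Category.assoc, h, sq.inr_desc]; exact K'.weq_p
  · rw [in₀, in₀, Category.assoc, ← Category.assoc K.j, sq.w, Category.assoc, Category.assoc,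
      reassoc_of% e0, Category.assoc]
  · rw [in₁, in₁, Category.assoc, ← Category.assoc K.j, sq.w, Category.assoc, Category.assoc,
      reassoc_of% e1, Category.assoc]

end RelCylinder

end Basic

/-! ### Relative homotopy as an equivalence relation; Reedy trivial cofibrations -/

section Homotopy

variable {C : Type u} [SmallCategory C] [CylinderCategory C]

/-- This is the exactness condition defining the completion, read through the Yoneda lemma. It lets
maps and homotopies be glued from pieces in `C`. -/
lemma yo_isPushout {A B A' B' : C} {i : A ⟶ B} {f : A ⟶ A'} {g : B ⟶ B'} {i' : A' ⟶ B'}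
    (hi : cof i) (sq : IsPushout i f g i') :
    IsPushout ((yo C).map i) ((yo C).map f) ((yo C).map g) ((yo C).map i') := by
  have key : ∀ (X : Completion C) (b : (yo C).obj B ⟶ X) (a : (yo C).obj A' ⟶ X),
      (yo C).map i ≫ b = (yo C).map f ≫ a →
        ∃ t : (yo C).obj B' ⟶ X, (yo C).map g ≫ t = b ∧ (yo C).map i' ≫ t = a := by
    intro X b a h
    obtain ⟨-, -, hs⟩ := (Types.isPullback_iff _ _ _ _).1 (X.property.2 i f g i' hi sq)
    obtain ⟨t, h1, h2⟩ := hs (elt _ _ b) (elt _ _ a) (by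
      rw [← elt_map_comp, ← elt_map_comp, h])
    refine ⟨(elt _ _).symm t, (elt _ _).injective ?_, (elt _ _).injective ?_⟩
    · rw [elt_map_comp, Equiv.apply_symm_apply, h1]
    · rw [elt_map_comp, Equiv.apply_symm_apply, h2]
  have uniq : ∀ (X : Completion C) (s t : (yo C).obj B' ⟶ X),
      (yo C).map g ≫ s = (yo C).map g ≫ t → (yo C).map i' ≫ s = (yo C).map i' ≫ t → s = t := by
    intro X s t h1 h2
    obtain ⟨-, hs, -⟩ := (Types.isPullback_iff _ _ _ _).1 (X.property.2 i f g i' hi sq)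
    apply (elt _ _).injective
    apply hs
    rw [← elt_map_comp, ← elt_map_comp, ← elt_map_comp, ← elt_map_comp, h1, h2]
    exact ⟨rfl, rfl⟩
  have w : (yo C).map i ≫ (yo C).map g = (yo C).map f ≫ (yo C).map i' := by
    rw [← Functor.map_comp, sq.w, Functor.map_comp]
  choose d hd using key
  exact ⟨⟨w⟩, ⟨PushoutCocone.IsColimit.mk w (fun s => d s.pt s.inl s.inr s.condition)
    (fun s => (hd _ _ _ s.condition).1) (fun s => (hd _ _ _ s.condition).2)
    (fun s m h1 h2 => uniq _ _ _ (h1.trans (hd _ _ _ s.condition).1.symm)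
      (h2.trans (hd _ _ _ s.condition).2.symm))⟩⟩

/-- Precomposing with a retraction of `i` suffices: every object of the completion behaves as a
fibrant one. -/
lemma exists_extension {A B : C} {i : A ⟶ B} (hi : trivCof i) {X : Completion C}
    (x : (yo C).obj A ⟶ X) : ∃ y : (yo C).obj B ⟶ X, (yo C).map i ≫ y = x := by
  obtain ⟨r, hr⟩ := exists_retraction i hi.1 hi.2
  refine ⟨(yo C).map r ≫ x, ?_⟩
  rw [← Functor.map_comp_assoc, hr, CategoryTheory.Functor.map_id]
  exact Category.id_comp x

section

variable {A B : C} {i : A ⟶ B} {X : Completion C}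

lemma homotopicRel_iff {f g : (yo C).obj B ⟶ X} :
    HomotopicRel i f g ↔ ∃ (K : RelCylinder i) (h : (yo C).obj K.cyl ⟶ X),
      (yo C).map K.in₀ ≫ h = f ∧ (yo C).map K.in₁ ≫ h = g := Iff.rfl

/-- Homotopies may be parametrized by objects over which the codiagonal factors, even if the first
map of the factorization is not a cofibration. -/
lemma HomotopicRel.of_weq (hi : cof i) {G : C} (u₀ u₁ : B ⟶ G) (p : G ⟶ B) (hu : i ≫ u₀ = i ≫ u₁)
    (h₀ : u₀ ≫ p = 𝟙 B) (h₁ : u₁ ≫ p = 𝟙 B) (hp : weq p) {f g : (yo C).obj B ⟶ X}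
    (h : (yo C).obj G ⟶ X) (hf : (yo C).map u₀ ≫ h = f) (hg : (yo C).map u₁ ≫ h = g) :
    HomotopicRel i f g := by
  obtain ⟨P, l, r, sq, -⟩ := exists_isPushout i i hi
  -- Factoring `B ⨿_A B ⟶ G` yields a genuine cylinder with a map `q` to `G`, along which `h` is
  -- pulled back.
  obtain ⟨M, c, q, hc, hq, hcq⟩ := exists_factorization (sq.desc u₀ u₁ hu)
  have hl : l ≫ c ≫ q = u₀ := by rw [hcq, sq.inl_desc]
  have hr : r ≫ c ≫ q = u₁ := by rw [hcq, sq.inr_desc]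
  refine ⟨⟨P, l, r, sq, M, c, q ≫ p, hc, weq_comp _ _ hq hp, ?_, ?_⟩, (yo C).map q ≫ h, ?_, ?_⟩
  · rw [← h₀, ← hl]; simp
  · rw [← h₁, ← hr]; simp
  · simp only [← Functor.map_comp_assoc, Category.assoc, hl, hf]
  · simp only [← Functor.map_comp_assoc, Category.assoc, hr, hg]

/-- The choice of cylinder is immaterial: the homotopy extends over a common trivial extension of
both cylinders and is then restricted to `K`. -/
lemma HomotopicRel.exists_of_cylinder {f g : (yo C).obj B ⟶ X}
    (h : HomotopicRel i f g) (K : RelCylinder i) :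
    ∃ k : (yo C).obj K.cyl ⟶ X, (yo C).map K.in₀ ≫ k = f ∧ (yo C).map K.in₁ ≫ k = g := by
  obtain ⟨K', k', rfl, rfl⟩ := homotopicRel_iff.1 h
  obtain ⟨L, a, b, ha, -, h0, h1⟩ := K'.exists_common K
  obtain ⟨k, rfl⟩ := exists_extension ha k'
  refine ⟨(yo C).map b ≫ k, ?_, ?_⟩
  · rw [← Functor.map_comp_assoc, ← Functor.map_comp_assoc, h0]
  · rw [← Functor.map_comp_assoc, ← Functor.map_comp_assoc, h1]

lemma HomotopicRel.refl (hi : cof i) (f : (yo C).obj B ⟶ X) : HomotopicRel i f f :=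
  .of_weq hi (𝟙 B) (𝟙 B) (𝟙 B) rfl (Category.comp_id _) (Category.comp_id _) (weq_id B) f
    (by simp) (by simp)

lemma HomotopicRel.symm (hi : cof i) {f g : (yo C).obj B ⟶ X} (h : HomotopicRel i f g) :
    HomotopicRel i g f := by
  obtain ⟨K, k, rfl, rfl⟩ := homotopicRel_iff.1 h
  exact .of_weq hi K.in₁ K.in₀ K.p K.comp_in₀.symm K.in₁_p K.in₀_p K.weq_p k rfl rfl

/-- The two cylinders are glued end to end. `HomotopicRel.of_weq` removes the need to check that the
boundary of the result is included by a cofibration. -/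
lemma HomotopicRel.trans (hi : cof i) {f g k : (yo C).obj B ⟶ X} (h : HomotopicRel i f g)
    (h' : HomotopicRel i g k) : HomotopicRel i f k := by
  obtain ⟨K, a, rfl, rfl⟩ := homotopicRel_iff.1 h
  obtain ⟨K', b, hab, rfl⟩ := homotopicRel_iff.1 h'
  have t0 := K'.trivCof_in₀ hi
  obtain ⟨G, l, r, sq, -⟩ := exists_isPushout K'.in₀ K.in₁ t0.1
  have tr := trivCof.of_isPushout sq t0
  let p : G ⟶ B := sq.desc K'.p K.p (by rw [K'.in₀_p, K.in₁_p])
  have hl : l ≫ p = K'.p := sq.inl_desc _ _ _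
  have hr : r ≫ p = K.p := sq.inr_desc _ _ _
  have sq' := yo_isPushout t0.1 sq
  refine .of_weq hi (K.in₀ ≫ r) (K'.in₁ ≫ l) p ?_ ?_ ?_ (weq_of_comp_left tr.2 (hr ▸ K.weq_p))
    (sq'.desc b a hab) ?_ ?_
  · rw [← Category.assoc, K.comp_in₀, Category.assoc, ← sq.w, ← Category.assoc, K'.comp_in₀,
      Category.assoc]
  · rw [Category.assoc, hr, K.in₀_p]
  · rw [Category.assoc, hl, K'.in₁_p]
  · rw [Functor.map_comp, Category.assoc, sq'.inr_desc]
  · rw [Functor.map_comp, Category.assoc, sq'.inl_desc]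

lemma HomotopicRel.comp {f g : (yo C).obj B ⟶ X} (h : HomotopicRel i f g) {Y : Completion C}
    (w : X ⟶ Y) : HomotopicRel i (f ≫ w) (g ≫ w) := by
  obtain ⟨K, k, rfl, rfl⟩ := homotopicRel_iff.1 h
  exact homotopicRel_iff.2 ⟨K, k ≫ w, by simp, by simp⟩

lemma piSet_mk_eq_iff (hi : cof i) {x : (yo C).obj A ⟶ X}
    (f g : {f : (yo C).obj B ⟶ X // (yo C).map i ≫ f = x}) :
    (Quot.mk _ f : PiSet i X x) = Quot.mk _ g ↔ HomotopicRel i f.1 g.1 := by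
  constructor
  · intro h
    have h' := Quot.eqvGen_exact h
    clear h
    induction h' with
    | rel _ _ h => exact h
    | refl f => exact .refl hi _
    | symm f g _ h => exact h.symm hi
    | trans f g k _ _ h h' => exact h.trans hi h'
  · exact fun h => Quot.sound h

end

/-- A square from the cofibration `i` to the cofibration `j` that is a Reedy trivial cofibration:
the morphism `α` between the sources and the morphism from `B ⨿_A A'` to `B'` are both trivial
cofibrations. -/
structure ReedyTrivCof {A B A' B' : C} (i : A ⟶ B) (j : A' ⟶ B') where
  α : A ⟶ A'
  β : B ⟶ B'
  P : C
  l : B ⟶ P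
  r : A' ⟶ P
  sq : IsPushout i α l r
  γ : P ⟶ B'
  trivCof_α : trivCof α
  trivCof_γ : trivCof γ
  l_γ : l ≫ γ = β
  r_γ : r ≫ γ = j

namespace ReedyTrivCof

variable {A B A' B' : C} {i : A ⟶ B} {j : A' ⟶ B'} (R : ReedyTrivCof i j) (hi : cof i)

lemma w : i ≫ R.β = R.α ≫ j := by
  rw [← R.l_γ, R.sq.w_assoc, R.r_γ]

include hi in
lemma cof_r : cof R.r := cof_of_isPushout R.sq hi

include R hi in
lemma cof_j : cof j := by
  rw [← R.r_γ]
  exact cof_comp _ _ (R.cof_r hi) R.trivCof_γ.1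

lemma trivCof_l : trivCof R.l := trivCof.of_isPushout R.sq.flip R.trivCof_α

lemma trivCof_β : trivCof R.β := by
  rw [← R.l_γ]
  exact R.trivCof_l.comp R.trivCof_γ

variable {X : Completion C}

include hi in
/-- Homotopies relative to `A'` restrict along `B ⟶ B'` to homotopies relative to `A`. -/
lemma homotopicRel_restrict {p q : (yo C).obj B' ⟶ X} (h : HomotopicRel j p q) :
    HomotopicRel i ((yo C).map R.β ≫ p) ((yo C).map R.β ≫ q) := by
  obtain ⟨K, k, rfl, rfl⟩ := homotopicRel_iff.1 h
  -- A retraction of `R.β` is a weak equivalence, so the cylinder on `B'` also serves as a homotopy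
  -- parameter object over `B`.
  obtain ⟨r, hr⟩ := exists_retraction R.β R.trivCof_β.1 R.trivCof_β.2
  refine .of_weq hi (R.β ≫ K.in₀) (R.β ≫ K.in₁) (K.p ≫ r) ?_ ?_ ?_ (weq_comp _ _ K.weq_p ?_) k
    (by simp) (by simp)
  · rw [← Category.assoc, ← Category.assoc, R.w, Category.assoc, K.comp_in₀, Category.assoc]
  · rw [Category.assoc, ← Category.assoc K.in₀, K.in₀_p, Category.id_comp, hr]
  · rw [Category.assoc, ← Category.assoc K.in₁, K.in₁_p, Category.id_comp, hr]
  · exact weq_of_comp_left R.trivCof_β.2 (by rw [hr]; exact weq_id B)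

end ReedyTrivCof

end Homotopy

/-! ### Transport of homotopies and homotopy fillers along weak equivalences -/

section Transport

variable {C : Type u} [SmallCategory C] [CylinderCategory C]

/-- Homotopies relative to `A` extend along a cobase change `B ⟶ B ⨿_A A'` of a trivial
cofibration `A ⟶ A'` to homotopies relative to `A'`. -/
lemma HomotopicRel.of_isPushout {A B A' P : C} {i : A ⟶ B} {α : A ⟶ A'} {l : B ⟶ P} {r : A' ⟶ P}
    (hi : cof i) (hα : trivCof α) (sq : IsPushout i α l r) {X : Completion C}
    {p q : (yo C).obj P ⟶ X} (hpq : (yo C).map r ≫ p = (yo C).map r ≫ q)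
    (h : HomotopicRel i ((yo C).map l ≫ p) ((yo C).map l ≫ q)) : HomotopicRel r p q := by
  obtain ⟨K, k, hk0, hk1⟩ := homotopicRel_iff.1 h
  have hc : cof (i ≫ K.in₀) := cof_comp _ _ hi (K.trivCof_in₀ hi).1
  obtain ⟨G, a, b, sqG, -⟩ := exists_isPushout (i ≫ K.in₀) α hc
  have ta := trivCof.of_isPushout sqG.flip hα
  have w0 : i ≫ K.in₀ ≫ a = α ≫ b := by rw [← Category.assoc, sqG.w]
  have w1 : i ≫ K.in₁ ≫ a = α ≫ b := by
    rw [← Category.assoc, ← K.comp_in₀, sqG.w]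
  let u₀ : P ⟶ G := sq.desc (K.in₀ ≫ a) b w0
  let u₁ : P ⟶ G := sq.desc (K.in₁ ≫ a) b w1
  have l0 : l ≫ u₀ = K.in₀ ≫ a := sq.inl_desc _ _ _
  have l1 : l ≫ u₁ = K.in₁ ≫ a := sq.inl_desc _ _ _
  have r0 : r ≫ u₀ = b := sq.inr_desc _ _ _
  have r1 : r ≫ u₁ = b := sq.inr_desc _ _ _
  let π : G ⟶ P := sqG.desc (K.p ≫ l) r (by
    rw [Category.assoc, reassoc_of% K.in₀_p, sq.w])
  have aπ : a ≫ π = K.p ≫ l := sqG.inl_desc _ _ _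
  have bπ : b ≫ π = r := sqG.inr_desc _ _ _
  have tl : trivCof l := trivCof.of_isPushout sq.flip hα
  have sq' := yo_isPushout hi sq
  have sqG' := yo_isPushout hc sqG
  have wk : (yo C).map (i ≫ K.in₀) ≫ k = (yo C).map α ≫ (yo C).map r ≫ p := by
    rw [Functor.map_comp_assoc, hk0, ← Functor.map_comp_assoc, sq.w, Functor.map_comp_assoc]
  have hl : (yo C).map a ≫ sqG'.desc k ((yo C).map r ≫ p) wk = k := sqG'.inl_desc _ _ _
  have hr : (yo C).map b ≫ sqG'.desc k ((yo C).map r ≫ p) wk = (yo C).map r ≫ p :=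
    sqG'.inr_desc _ _ _
  refine .of_weq (cof_of_isPushout sq hi) u₀ u₁ π (r0.trans r1.symm) ?_ ?_
    (weq_of_comp_left ta.2 (by rw [aπ]; exact weq_comp _ _ K.weq_p tl.2))
    (sqG'.desc k ((yo C).map r ≫ p) wk) ?_ ?_
  · apply sq.hom_ext
    · rw [reassoc_of% l0, aπ, reassoc_of% K.in₀_p, Category.comp_id]
    · rw [reassoc_of% r0, bπ, Category.comp_id]
  · apply sq.hom_ext
    · rw [reassoc_of% l1, aπ, reassoc_of% K.in₁_p, Category.comp_id]
    · rw [reassoc_of% r1, bπ, Category.comp_id]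
  · apply sq'.hom_ext
    · rw [← Functor.map_comp_assoc, l0, Functor.map_comp_assoc, hl, hk0]
    · rw [← Functor.map_comp_assoc, r0, hr]
  · apply sq'.hom_ext
    · rw [← Functor.map_comp_assoc, l1, Functor.map_comp_assoc, hl, hk1]
    · rw [← Functor.map_comp_assoc, r1, hr, hpq]

/-- Homotopies extend along trivial cofibrations. -/
lemma HomotopicRel.of_trivCof {A B B' : C} {i : A ⟶ B} {γ : B ⟶ B'} (hi : cof i)
    (hγ : trivCof γ) {X : Completion C} {p q : (yo C).obj B' ⟶ X}
    (h : HomotopicRel i ((yo C).map γ ≫ p) ((yo C).map γ ≫ q)) : HomotopicRel (i ≫ γ) p q := by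
  obtain ⟨K, k, hk0, hk1⟩ := homotopicRel_iff.1 h
  -- A copy of `B'` is glued to each end of the cylinder on `B`: `p` lives on the first copy, `q` on
  -- the second, and `k` in between.
  obtain ⟨G₁, a, b, sq₁, -⟩ := exists_isPushout γ K.in₀ hγ.1
  have tb := trivCof.of_isPushout sq₁ hγ
  obtain ⟨G, c, d, sq, -⟩ := exists_isPushout γ (K.in₁ ≫ b) hγ.1
  have td := trivCof.of_isPushout sq hγ
  let π₁ : G₁ ⟶ B' := sq₁.desc (𝟙 B') (K.p ≫ γ) (by
    rw [← Category.assoc, K.in₀_p, Category.comp_id, Category.id_comp])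
  have aπ : a ≫ π₁ = 𝟙 B' := sq₁.inl_desc _ _ _
  have bπ : b ≫ π₁ = K.p ≫ γ := sq₁.inr_desc _ _ _
  let π : G ⟶ B' := sq.desc (𝟙 B') π₁ (by
    rw [Category.assoc, bπ, ← Category.assoc, K.in₁_p, Category.comp_id, Category.id_comp])
  have cπ : c ≫ π = 𝟙 B' := sq.inl_desc _ _ _
  have dπ : d ≫ π = π₁ := sq.inr_desc _ _ _
  have sq₁' := yo_isPushout hγ.1 sq₁
  have sq' := yo_isPushout hγ.1 sq
  obtain ⟨t₁, ha, hb⟩ : ∃ t, (yo C).map a ≫ t = p ∧ (yo C).map b ≫ t = k :=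
    ⟨sq₁'.desc p k hk0.symm, sq₁'.inl_desc _ _ _, sq₁'.inr_desc _ _ _⟩
  have ht : (yo C).map γ ≫ q = (yo C).map (K.in₁ ≫ b) ≫ t₁ := by
    rw [Functor.map_comp_assoc, hb, hk1]
  have wb : weq π₁ := weq_of_comp_left tb.2 (by rw [bπ]; exact weq_comp _ _ K.weq_p hγ.2)
  refine .of_weq (cof_comp _ _ hi hγ.1) (a ≫ d) c π ?_ (by rw [Category.assoc, dπ, aπ]) cπ
    (weq_of_comp_left td.2 (by rw [dπ]; exact wb)) (sq'.desc q t₁ ht) ?_ (sq'.inl_desc _ _ _)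
  · rw [Category.assoc, Category.assoc, sq.w, reassoc_of% sq₁.w, ← Category.assoc, K.comp_in₀]
    simp only [Category.assoc]
  · rw [Functor.map_comp_assoc, sq'.inr_desc, ha]

/-- The square `(x, v)` from the cofibration `i` to `f` has a filler that makes the upper triangle
commute and the lower one commute up to a homotopy relative to the source of `i`. -/
def HasHomotopyFiller {A B : C} (i : A ⟶ B) {X Y : Completion C} (f : X ⟶ Y)
    (x : (yo C).obj A ⟶ X) (v : (yo C).obj B ⟶ Y) : Prop :=
  ∃ a : (yo C).obj B ⟶ X, (yo C).map i ≫ a = x ∧ HomotopicRel i (a ≫ f) v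

namespace ReedyTrivCof

variable {A B A' B' : C} {i : A ⟶ B} {j : A' ⟶ B'} (R : ReedyTrivCof i j) (hi : cof i)
  {X Y : Completion C} {f : X ⟶ Y}

include R hi in
lemma homotopicRel_extend {p q : (yo C).obj B' ⟶ X}
    (hpq : (yo C).map j ≫ p = (yo C).map j ≫ q)
    (h : HomotopicRel i ((yo C).map R.β ≫ p) ((yo C).map R.β ≫ q)) : HomotopicRel j p q := by
  have h' : HomotopicRel R.r ((yo C).map R.γ ≫ p) ((yo C).map R.γ ≫ q) := by
    apply HomotopicRel.of_isPushout hi R.trivCof_α R.sq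
    · simpa only [← Functor.map_comp_assoc, R.r_γ] using hpq
    · simpa only [← Functor.map_comp_assoc, R.l_γ] using h
  have := h'.of_trivCof (R.cof_r hi) R.trivCof_γ
  rwa [R.r_γ] at this

-- The data glue on `B ⨿_A A'` and then extend along the trivial cofibration `R.γ`, so both
-- restrictions are strict.
include hi in
lemma exists_extension_pair {x : (yo C).obj A' ⟶ X} {b : (yo C).obj B ⟶ X}
    (h : (yo C).map i ≫ b = (yo C).map R.α ≫ x) :
    ∃ t : (yo C).obj B' ⟶ X, (yo C).map j ≫ t = x ∧ (yo C).map R.β ≫ t = b := by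
  have sq' := yo_isPushout hi R.sq
  obtain ⟨t, ht⟩ := exists_extension R.trivCof_γ (sq'.desc b x h)
  refine ⟨t, ?_, ?_⟩
  · rw [← sq'.inr_desc b x h, ← ht, ← Functor.map_comp_assoc, R.r_γ]
  · rw [← sq'.inl_desc b x h, ← ht, ← Functor.map_comp_assoc, R.l_γ]

include hi in
lemma hasHomotopyFiller_restrict {x : (yo C).obj A' ⟶ X} {v : (yo C).obj B' ⟶ Y}
    (h : HasHomotopyFiller j f x v) :
    HasHomotopyFiller i f ((yo C).map R.α ≫ x) ((yo C).map R.β ≫ v) := by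
  obtain ⟨a, rfl, ha⟩ := h
  refine ⟨(yo C).map R.β ≫ a, ?_, ?_⟩
  · rw [← Functor.map_comp_assoc, R.w, Functor.map_comp_assoc]
  · rw [Category.assoc]
    exact R.homotopicRel_restrict hi ha

include hi in
lemma hasHomotopyFiller_extend {x : (yo C).obj A' ⟶ X} {v : (yo C).obj B' ⟶ Y}
    (hxv : x ≫ f = (yo C).map j ≫ v)
    (h : HasHomotopyFiller i f ((yo C).map R.α ≫ x) ((yo C).map R.β ≫ v)) :
    HasHomotopyFiller j f x v := by
  obtain ⟨b, hb, hb'⟩ := h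
  obtain ⟨a, rfl, rfl⟩ := R.exists_extension_pair hi hb
  refine ⟨a, rfl, R.homotopicRel_extend hi ?_ ?_⟩
  · rw [← hxv, Category.assoc]
  · simpa only [Category.assoc] using hb'

end ReedyTrivCof

/-- Two cofibrations over a common morphism, with all comparison morphisms weak equivalences, have
a common Reedy trivial extension, which may be prescribed on the sources. -/
lemma exists_reedyTrivCof {A B A₁ B₁ A₂ Z : C} {j : A ⟶ B} {j₁ : A₁ ⟶ B₁} (hj : cof j)
    (hj₁ : cof j₁) {α : A ⟶ A₂} {α₁ : A₁ ⟶ A₂} (hα : trivCof α) (hα₁ : trivCof α₁) {m : A₂ ⟶ Z}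
    {β : B ⟶ Z} {β₁ : B₁ ⟶ Z} (hβ : weq β) (hβ₁ : weq β₁) (w : j ≫ β = α ≫ m)
    (w₁ : j₁ ≫ β₁ = α₁ ≫ m) :
    ∃ (B₂ : C) (k : A₂ ⟶ B₂) (R : ReedyTrivCof j k) (R₁ : ReedyTrivCof j₁ k) (q : B₂ ⟶ Z),
      R.α = α ∧ R₁.α = α₁ ∧ R.β ≫ q = β ∧ R₁.β ≫ q = β₁ ∧ k ≫ q = m := by
  -- Both cofibrations are pushed forward to `A₂` and glued there; the resulting map to `Z` is then
  -- factored.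
  obtain ⟨P, l, r, sq, cr⟩ := exists_isPushout j α hj
  obtain ⟨P₁, l₁, r₁, sq₁, cr₁⟩ := exists_isPushout j₁ α₁ hj₁
  obtain ⟨Q, s, s₁, sqQ, cs₁⟩ := exists_isPushout r r₁ cr
  have cs : cof s := cof_of_isPushout sqQ.flip cr₁
  obtain ⟨B₂, c, q, hc, hq, hcq⟩ := exists_factorization
    (sqQ.desc (sq.desc β m w) (sq₁.desc β₁ m w₁) (by rw [sq.inr_desc, sq₁.inr_desc]))
  have hl : l ≫ s ≫ c ≫ q = β := by rw [hcq, sqQ.inl_desc, sq.inl_desc]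
  have hl₁ : l₁ ≫ s₁ ≫ c ≫ q = β₁ := by rw [hcq, sqQ.inr_desc, sq₁.inl_desc]
  have tl := trivCof.of_isPushout sq.flip hα
  have tl₁ := trivCof.of_isPushout sq₁.flip hα₁
  refine ⟨B₂, r ≫ s ≫ c,
    ⟨α, l ≫ s ≫ c, P, l, r, sq, s ≫ c, hα, ⟨cof_comp _ _ cs hc, ?_⟩, rfl, rfl⟩,
    ⟨α₁, l₁ ≫ s₁ ≫ c, P₁, l₁, r₁, sq₁, s₁ ≫ c, hα₁, ⟨cof_comp _ _ cs₁ hc, ?_⟩, rfl,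
      by rw [reassoc_of% sqQ.w]⟩, q, rfl, rfl, by simpa using hl, by simpa using hl₁, ?_⟩
  · exact weq_of_comp_right hq (weq_of_comp_left tl.2 (by simpa [hl] using hβ))
  · exact weq_of_comp_right hq (weq_of_comp_left tl₁.2 (by simpa [hl₁] using hβ₁))
  · simp only [Category.assoc, hcq, sqQ.inl_desc, sq.inr_desc]

/-- The homotopy lifting property against a cofibration only depends on the weak equivalence class
of the cofibration. -/
lemma hasHomotopyFiller_of_weq {A B A₁ B₁ W Z : C} {j : A ⟶ B} {j₁ : A₁ ⟶ B₁} (hj : cof j)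
    (hj₁ : cof j₁) {α : A ⟶ W} {α₁ : A₁ ⟶ W} (hα : weq α) (hα₁ : weq α₁) {m : W ⟶ Z}
    {β : B ⟶ Z} {β₁ : B₁ ⟶ Z} (hβ : weq β) (hβ₁ : weq β₁) (w : j ≫ β = α ≫ m)
    (w₁ : j₁ ≫ β₁ = α₁ ≫ m) {X Y : Completion C} {f : X ⟶ Y}
    (H : ∀ (x : (yo C).obj A ⟶ X) (v : (yo C).obj B ⟶ Y), x ≫ f = (yo C).map j ≫ v →
      HasHomotopyFiller j f x v)
    (x : (yo C).obj A₁ ⟶ X) (v : (yo C).obj B₁ ⟶ Y) (hxv : x ≫ f = (yo C).map j₁ ≫ v) :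
    HasHomotopyFiller j₁ f x v := by
  have := hasInitial (C := C)
  obtain ⟨S, s, s₁, sqS, cs₁⟩ := exists_isPushout (initial.to A) (initial.to A₁)
    (cof_of_isInitial initialIsInitial)
  have cs : cof s := cof_of_isPushout sqS.flip (cof_of_isInitial initialIsInitial)
  -- Factoring `A ⨿ A₁ ⟶ W` gives a source that both `A` and `A₁` enter by trivial cofibrations. The
  -- problem for `j₁` is extended to the common Reedy extension `k`, restricted to `j` and solved
  -- there, and the solution is carried back.
  obtain ⟨A₂, c, q, hc, hq, hcq⟩ := exists_factorization
    (sqS.desc α α₁ (initialIsInitial.hom_ext _ _))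
  have h0 : (s ≫ c) ≫ q = α := by rw [Category.assoc, hcq, sqS.inl_desc]
  have h1 : (s₁ ≫ c) ≫ q = α₁ := by rw [Category.assoc, hcq, sqS.inr_desc]
  obtain ⟨B₂, k, R, R₁, -, hR, hR₁, -⟩ := exists_reedyTrivCof hj hj₁ (m := q ≫ m)
    ⟨cof_comp _ _ cs hc, weq_of_comp_right hq (h0 ▸ hα)⟩
    ⟨cof_comp _ _ cs₁ hc, weq_of_comp_right hq (h1 ▸ hα₁)⟩ hβ hβ₁
    (by rw [← Category.assoc, h0, w]) (by rw [← Category.assoc, h1, w₁])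
  obtain ⟨x₂, rfl⟩ := exists_extension R₁.trivCof_α x
  obtain ⟨v₂, hv₂, rfl⟩ := R₁.exists_extension_pair hj₁ (x := x₂ ≫ f) (b := v)
    (by rw [← hxv, Category.assoc])
  refine R₁.hasHomotopyFiller_restrict hj₁ (R.hasHomotopyFiller_extend hj hv₂.symm (H _ _ ?_))
  rw [Category.assoc, ← hv₂, ← Functor.map_comp_assoc, ← Functor.map_comp_assoc, R.w]

lemma completionWeq_comp {X Y Z : Completion C} {f : X ⟶ Y} {g : Y ⟶ Z}
    (hf : completionWeq C f) (hg : completionWeq C g) : completionWeq C (f ≫ g) := by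
  intro A B i x v hi hxv
  obtain ⟨b, hb, hb'⟩ := hg i (x ≫ f) v hi (by rwa [Category.assoc])
  obtain ⟨a, ha, ha'⟩ := hf i x b hi hb.symm
  refine ⟨a, ha, ?_⟩
  rw [← Category.assoc]
  exact (ha'.comp g).trans hi hb'

/-- A map `y : A ⟶ Y` lifts to `X` only up to homotopy. A Reedy trivial extension of `i` over the
cylinder on `A` transfers the problem from the end `y` to the end `a ≫ f`, where the hypothesis on
`f ≫ g` solves it. -/
lemma completionWeq_of_comp_left {X Y Z : Completion C} {f : X ⟶ Y} {g : Y ⟶ Z}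
    (hf : completionWeq C f) (hfg : completionWeq C (f ≫ g)) : completionWeq C g := by
  intro A B i y v hi hyv
  have := hasInitial (C := C)
  have c0 : cof (initial.to A) := cof_of_isInitial initialIsInitial
  have z : ∀ {T : Completion C} (s t : (yo C).obj (⊥_ C) ⟶ T), s = t := by
    intro T s t
    obtain ⟨hT⟩ := T.property.1 (⊥_ C) initialIsInitial
    exact (elt _ _).injective (Subsingleton.elim _ _)
  obtain ⟨e⟩ : Nonempty ((yo C).obj (⊥_ C) ⟶ X) := by
    obtain ⟨hT⟩ := X.property.1 (⊥_ C) initialIsInitial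
    exact ⟨(elt _ _).symm default⟩
  -- Lifting relative to the initial object makes the boundary condition vacuous.
  obtain ⟨a, -, ha⟩ := hf (initial.to A) e y c0 (z _ _)
  obtain ⟨K, h, h0, h1⟩ := homotopicRel_iff.1 ha
  obtain ⟨B₂, k, R₀, R₁, -, hR₀, hR₁, -⟩ := exists_reedyTrivCof hi hi (K.trivCof_in₀ c0)
    (K.trivCof_in₁ c0) (m := K.p ≫ i) (weq_id B) (weq_id B)
    (by rw [reassoc_of% K.in₀_p, Category.comp_id])
    (by rw [reassoc_of% K.in₁_p, Category.comp_id])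
  obtain ⟨v₂, hv₂, rfl⟩ := R₁.exists_extension_pair hi (x := h ≫ g) (b := v)
    (by rw [hR₁, reassoc_of% h1, hyv])
  obtain rfl : (yo C).map R₁.α ≫ h = y := by rw [hR₁, h1]
  refine R₁.hasHomotopyFiller_restrict hi (R₀.hasHomotopyFiller_extend hi hv₂.symm ?_)
  obtain ⟨b, hb, hb'⟩ := hfg i a ((yo C).map R₀.β ≫ v₂) hi (by
    rw [← Functor.map_comp_assoc, R₀.w, Functor.map_comp_assoc, hv₂, hR₀, reassoc_of% h0])
  refine ⟨b ≫ f, ?_, by simpa only [Category.assoc] using hb'⟩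
  rw [reassoc_of% hb, hR₀, h0]

end Transport

/-! ### Restriction along `F`, reflection of weak equivalences, and the unit -/

section Restriction

variable {C D : Type u} [SmallCategory C] [SmallCategory D] [CylinderCategory C]
  [CylinderCategory D] {F : C ⥤ D} (hF : IsMorphism F)

/-- The homotopy in `D` may be taken through the image of a cylinder from `C`, and then it
transposes. -/
lemma homotopicRel_of_transpose {A B : C} {i : A ⟶ B} (hi : cof i) {Y : Completion D}
    {f g : (yo C).obj B ⟶ (restr hF).obj Y}
    (h : HomotopicRel (F.map i) (transpose hF f) (transpose hF g)) : HomotopicRel i f g := by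
  obtain ⟨K⟩ := exists_relCylinder i hi
  obtain ⟨k, h0, h1⟩ := h.exists_of_cylinder (K.map hF hi)
  obtain ⟨k, rfl⟩ := (transpose hF (B := K.cyl)).surjective k
  refine homotopicRel_iff.2 ⟨K, k, (transpose hF).injective ?_, (transpose hF).injective ?_⟩
  · rw [map_comp_transpose, ← h0, RelCylinder.in₀, RelCylinder.in₀, F.map_comp]
    rfl
  · rw [map_comp_transpose, ← h1, RelCylinder.in₁, RelCylinder.in₁, F.map_comp]
    rfl

lemma bijective_piTranspose (Y : Completion D) {A B : C} (i : A ⟶ B) (hi : cof i)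
    (y : (yo D).obj (F.obj A) ⟶ Y) : Function.Bijective (piTranspose hF i hi Y y) := by
  constructor
  · rintro ⟨f⟩ ⟨g⟩ h
    exact (piSet_mk_eq_iff hi f g).2
      (homotopicRel_of_transpose hF hi ((piSet_mk_eq_iff (hF.map_cof i hi) _ _).1 h))
  · rintro ⟨⟨g, hg⟩⟩
    obtain ⟨f, rfl⟩ := (transpose hF (B := B)).surjective g
    exact ⟨Quot.mk _ ⟨f, (transpose hF).injective (by
      rw [map_comp_transpose, hg, Equiv.apply_symm_apply])⟩, rfl⟩

lemma restr_map_fib {X Y : Completion D} {f : X ⟶ Y} (hf : (genTrivCof D).rlp f) :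
    (genTrivCof C).rlp ((restr hF).map f) := by
  rintro _ _ _ ⟨i, hi, hi'⟩
  have := hf _ (.mk (F.map i) (hF.map_cof i hi) (hF.map_weq i hi'))
  refine ⟨fun {x v} sq => ?_⟩
  have sq' : CommSq (transpose hF x) ((yo D).map (F.map i)) f (transpose hF v) :=
    ⟨by rw [← map_comp_transpose, ← sq.w, transpose_comp]⟩
  refine ⟨⟨⟨(transpose hF).symm sq'.lift, (transpose hF).injective ?_,
    (transpose hF).injective ?_⟩⟩⟩
  · rw [map_comp_transpose, Equiv.apply_symm_apply, sq'.fac_left]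
  · rw [transpose_comp, Equiv.apply_symm_apply, sq'.fac_right]

lemma hasHomotopyFiller_restr_map_iff {X Y : Completion D} (f : X ⟶ Y) {A B : C} {i : A ⟶ B}
    (hi : cof i) (x : (yo C).obj A ⟶ (restr hF).obj X) (v : (yo C).obj B ⟶ (restr hF).obj Y) :
    HasHomotopyFiller i ((restr hF).map f) x v ↔
      HasHomotopyFiller (F.map i) f (transpose hF x) (transpose hF v) := by
  constructor
  · rintro ⟨a, rfl, ha⟩
    refine ⟨transpose hF a, (map_comp_transpose hF i a).symm, ?_⟩
    rw [← transpose_comp]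
    exact ha.transpose hF hi
  · rintro ⟨a, ha, ha'⟩
    obtain ⟨a, rfl⟩ := (transpose hF (B := B)).surjective a
    refine ⟨a, (transpose hF).injective (by rw [map_comp_transpose, ha]),
      homotopicRel_of_transpose hF hi ?_⟩
    rwa [transpose_comp]

lemma restr_map_weq {X Y : Completion D} {f : X ⟶ Y} (hf : completionWeq D f) :
    completionWeq C ((restr hF).map f) := by
  intro A B i x v hi hxv
  refine (hasHomotopyFiller_restr_map_iff hF f hi x v).2 (hf _ _ _ (hF.map_cof i hi) ?_)
  rw [← transpose_comp, hxv, map_comp_transpose]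

/-- Fillers are known against the cofibrations `F i'`. Homotopy surjectivity replaces the ends of
`i` by objects in the image of `F`, homotopy full faithfulness replaces the map between them, and
fillers are transported along the resulting zigzag. -/
lemma weq_of_restr_map_weq (h : Acyclic F) {X Y : Completion D} {f : X ⟶ Y}
    (hf : completionWeq C ((restr hF).map f)) : completionWeq D f := by
  obtain ⟨hs, hff⟩ := h
  intro A B i x v hi hxv
  have := hasInitial (C := C)
  obtain ⟨A', a, ha⟩ := hs A
  obtain ⟨B'', b, hb⟩ := hs B
  -- The mapping cylinder of `a` supplies a weak equivalence `s ≫ ρ : F A' ⟶ A` in the reverse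
  -- direction.
  obtain ⟨M, c, q, s, hc, hq, hcq, -, ts⟩ := exists_mappingCylinder a
  have hcw : weq c := weq_of_comp_right hq (hcq ▸ ha)
  obtain ⟨ρ, hρ⟩ := exists_retraction c hc hcw
  have hr : weq (s ≫ ρ) := weq_comp _ _ ts.2
    (weq_of_comp_left hcw (by rw [hρ]; exact weq_id A))
  obtain ⟨h0⟩ := hF.map_initial (initialIsInitial (C := C))
  have c0 : cof (initial.to A') := cof_of_isInitial initialIsInitial
  obtain ⟨u, -, K, k, hk0, hk1⟩ := hff (initial.to A') (initial.to B'')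
    ((s ≫ ρ) ≫ i ≫ b) c0 (h0.hom_ext _ _)
  obtain ⟨B', i', q', hi', hq', hu⟩ := exists_factorization u
  obtain ⟨E, i₃, q₃, hi₃, hq₃, hm⟩ := exists_factorization ((s ≫ ρ) ≫ i ≫ b)
  have H1 : ∀ (x : (yo D).obj (F.obj A') ⟶ X) (v : (yo D).obj (F.obj B') ⟶ Y),
      x ≫ f = (yo D).map (F.map i') ≫ v → HasHomotopyFiller (F.map i') f x v := by
    intro x v hxv
    obtain ⟨x, rfl⟩ := (transpose hF (B := A')).surjective x
    obtain ⟨v, rfl⟩ := (transpose hF (B := B')).surjective v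
    refine (hasHomotopyFiller_restr_map_iff hF f hi' x v).1 (hf i' x v hi' ?_)
    apply (transpose hF).injective
    rw [transpose_comp, hxv, map_comp_transpose]
  have cF0 := hF.map_cof _ c0
  -- `F i'` and `i₃` represent the two ends of the homotopy `k`, so they are compared over its
  -- cylinder.
  have H2 := hasHomotopyFiller_of_weq (hF.map_cof i' hi') hi₃ (K.trivCof_in₀ cF0).2
    (K.trivCof_in₁ cF0).2 (m := k) (hF.map_weq q' hq') hq₃
    (by rw [← F.map_comp, hu, ← hk0, RelCylinder.in₀, Category.assoc])
    (by rw [hm, ← hk1, RelCylinder.in₁, Category.assoc]) H1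
  exact hasHomotopyFiller_of_weq hi₃ hi hr (weq_id A) (m := i ≫ b) hq₃ hb hm
    (Category.id_comp _).symm H2 x v hxv

/-- This identifies `UnitLifting` with the homotopy lifting condition on the unit, transposed to
`D`. -/
lemma applyExt_eq_transpose {B : C} {X : Completion C} (f : (yo C).obj B ⟶ X) :
    applyExt hF f = transpose hF (f ≫ (lanExtAdj hF).unit.app X) := by
  have h : (lanExtYo hF).hom.app B = transpose hF ((lanExtAdj hF).unit.app ((yo C).obj B)) := rfl
  have h' := (lanExtAdj hF).unit.naturality f
  dsimp only [Functor.id_obj, Functor.id_map, Functor.comp_obj, Functor.comp_map] at h'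
  rw [applyExt, h, ← transpose_comp, h']

lemma applyExt_comp {B : C} {X X' : Completion C} (f : (yo C).obj B ⟶ X) (g : X ⟶ X') :
    applyExt hF (f ≫ g) = applyExt hF f ≫ (lanExt F).map g := by
  rw [applyExt, applyExt, Functor.map_comp, Category.assoc]

/-- The unit of the adjunction satisfies the homotopy lifting property at `X`. -/
def UnitLifting (X : Completion C) : Prop :=
  ∀ {A B : C} (i : A ⟶ B) (x : (yo C).obj A ⟶ X)
    (v : (yo D).obj (F.obj B) ⟶ (lanExt F).obj X), cof i →
      (yo D).map (F.map i) ≫ v = applyExt hF x →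
        ∃ a : (yo C).obj B ⟶ X, (yo C).map i ≫ a = x ∧ HomotopicRel (F.map i) (applyExt hF a) v

lemma UnitLifting.weq_unit {X : Completion C} (h : UnitLifting hF X) :
    completionWeq C ((lanExtAdj hF).unit.app X) := by
  intro A B i x v hi hxv
  obtain ⟨a, ha, ha'⟩ := h i x (transpose hF v) hi
    (by rw [applyExt_eq_transpose, ← map_comp_transpose, hxv])
  refine ⟨a, ha, homotopicRel_of_transpose hF hi ?_⟩
  rwa [applyExt_eq_transpose] at ha'

lemma UnitLifting.retract {X X' : Completion C} (r : Retract X X') (h : UnitLifting hF X') :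
    UnitLifting hF X := by
  intro A B i x v hi hxv
  obtain ⟨a, ha, ha'⟩ := h i (x ≫ r.i) (v ≫ (lanExt F).map r.i) hi
    (by rw [applyExt_comp, ← hxv, Category.assoc])
  refine ⟨a ≫ r.r, ?_, ?_⟩
  · rw [reassoc_of% ha, r.retract, Category.comp_id]
  · have := ha'.comp ((lanExt F).map r.r)
    rwa [← applyExt_comp, Category.assoc, ← Functor.map_comp, r.retract,
      CategoryTheory.Functor.map_id, Category.comp_id] at this

lemma UnitLifting.bijective_piExt {X : Completion C} (h : UnitLifting hF X) {A B : C} (i : A ⟶ B)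
    (hi : cof i) (x : (yo C).obj A ⟶ X) : Function.Bijective (piExt hF i hi X x) := by
  constructor
  · rintro ⟨f⟩ ⟨g⟩ hfg
    refine (piSet_mk_eq_iff hi f g).2 ?_
    have hfg' := (piSet_mk_eq_iff (hF.map_cof i hi) _ _).1 hfg
    obtain ⟨K⟩ := exists_relCylinder i hi
    obtain ⟨k, h0, h1⟩ : ∃ k : (yo D).obj (F.obj K.cyl) ⟶ (lanExt F).obj X,
        (yo D).map (F.map K.inl) ≫ (yo D).map (F.map K.j) ≫ k = applyExt hF f.1 ∧
        (yo D).map (F.map K.inr) ≫ (yo D).map (F.map K.j) ≫ k = applyExt hF g.1 := by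
      obtain ⟨k, h0, h1⟩ := hfg'.exists_of_cylinder (K.map hF hi)
      exact ⟨k, ((yo D).map_comp_assoc _ _ _).symm.trans h0,
        ((yo D).map_comp_assoc _ _ _).symm.trans h1⟩
    have sq := yo_isPushout hi K.isPushout
    have sqF := yo_isPushout (hF.map_cof i hi) (hF.map_isPushout hi K.isPushout)
    -- Lifting against the boundary inclusion `K.j` gives a homotopy with ends exactly `f` and `g`;
    -- the lower triangle plays no role.
    obtain ⟨a, ha, -⟩ := h K.j (sq.desc f.1 g.1 (by rw [f.2, g.2])) k K.cof_j (by
      apply sqF.hom_ext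
      · rw [← applyExt_map_comp, sq.inl_desc, h0]
      · rw [← applyExt_map_comp, sq.inr_desc, h1])
    refine homotopicRel_iff.2 ⟨K, a, ?_, ?_⟩
    · rw [RelCylinder.in₀, Functor.map_comp_assoc, ha, sq.inl_desc]
    · rw [RelCylinder.in₁, Functor.map_comp_assoc, ha, sq.inr_desc]
  · rintro ⟨⟨v, hv⟩⟩
    obtain ⟨a, ha, ha'⟩ := h i x v hi hv
    exact ⟨Quot.mk _ ⟨a, ha⟩, (piSet_mk_eq_iff (hF.map_cof i hi) _ _).2 ha'⟩

end Restriction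

/-! ### Filtered colimits in the completion and ind-objects -/

section FilteredColimits

variable {C : Type u} [SmallCategory C] [CylinderCategory C]

/-- Continuity is orthogonality to maps between finitely presentable presheaves, so it is stable
under filtered colimits. These are therefore computed pointwise in the completion. -/
instance preservesFilteredColimits_ι (J : Type u) [SmallCategory J] [IsFiltered J] :
    PreservesColimitsOfShape J (isContinuous C).ι := by
  have : Fact (Cardinal.aleph0.{u}).IsRegular := ⟨Cardinal.isRegular_aleph0⟩
  have : IsCardinalFiltered J Cardinal.aleph0.{u} :=
    (isCardinalFiltered_aleph0_iff.{u} J).2 inferInstance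
  have : (isContinuous C).IsClosedUnderColimitsOfShape J := by
    rw [isContinuous_eq_isLocal]
    apply MorphismProperty.isClosedUnderColimitsOfShape_isLocal _ J Cardinal.aleph0.{u}
    rintro X Y f ⟨k⟩
    have hy := isCardinalPresentable_yoneda (E := C) Cardinal.aleph0.{u}
    rcases k with Z | s
    · refine ⟨?_, hy _⟩
      have : ∀ k, IsCardinalPresentable ((Functor.empty (Cᵒᵖ ⥤ Type u)).obj k)
        Cardinal.aleph0.{u} := by rintro ⟨⟨⟩⟩
      exact isCardinalPresentable_of_isColimit _ initialIsInitial Cardinal.aleph0.{u}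
        ((hasCardinalLT_aleph0_iff _).2 inferInstance)
    · refine ⟨?_, hy _⟩
      have : ∀ k, IsCardinalPresentable ((span (yoneda.map s.i) (yoneda.map s.f)).obj k)
          Cardinal.aleph0.{u} := by
        rintro (_ | _ | _)
        all_goals exact hy _
      exact isCardinalPresentable_of_isColimit _
        (colimit.isColimit (span (yoneda.map s.i) (yoneda.map s.f)))
        Cardinal.aleph0.{u}
        ((hasCardinalLT_aleph0_iff _).2 inferInstance)
  infer_instance

noncomputable instance : Reflective (isContinuous C).ι where
  L := reflector C
  adj := reflectorAdj C

instance : HasColimits (Completion C) := hasColimits_of_reflective (isContinuous C).ι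

variable {J : Type u} [SmallCategory J] [IsFiltered J]

lemma exists_factor_of_isColimit {K : J ⥤ Completion C} {c : Cocone K} (hc : IsColimit c) {B : C}
    (v : (yo C).obj B ⟶ c.pt) :
    ∃ (j : J) (w : (yo C).obj B ⟶ K.obj j), v = w ≫ c.ι.app j := by
  have h := isColimitOfPreserves ((isContinuous C).ι ⋙ (evaluation _ _).obj (op B)) hc
  obtain ⟨j, w, hw⟩ := Types.jointly_surjective_of_isColimit h (elt B _ v)
  refine ⟨j, (elt B _).symm w, (elt B _).injective ?_⟩
  rw [elt_comp, Equiv.apply_symm_apply, ← hw]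
  rfl

lemma exists_eq_of_isColimit {K : J ⥤ Completion C} {c : Cocone K} (hc : IsColimit c) {B : C}
    {j : J} {v w : (yo C).obj B ⟶ K.obj j} (h : v ≫ c.ι.app j = w ≫ c.ι.app j) :
    ∃ (k : J) (φ : j ⟶ k), v ≫ K.map φ = w ≫ K.map φ := by
  have h' := isColimitOfPreserves ((isContinuous C).ι ⋙ (evaluation _ _).obj (op B)) hc
  obtain ⟨k, φ, e⟩ := (Types.FilteredColimit.isColimit_eq_iff' h' (elt B _ v) (elt B _ w)).1 (by
    have := congrArg (elt B _) h
    rwa [elt_comp, elt_comp] at this)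
  refine ⟨k, φ, (elt B _).injective ?_⟩
  rw [elt_comp, elt_comp]
  exact e

lemma yo_map_surjective {A B : C} (f : (yo C).obj A ⟶ (yo C).obj B) :
    ∃ g : A ⟶ B, (yo C).map g = f :=
  ⟨yoneda.preimage f.hom, ObjectProperty.hom_ext _ (yoneda.map_preimage f.hom)⟩

lemma yo_map_injective {A B : C} {f g : A ⟶ B} (h : (yo C).map f = (yo C).map g) : f = g :=
  yoneda.map_injective (congrArg (fun k => k.hom) h)

/-- Objects of the completion that are filtered colimits of objects of `C`. -/
def IsInd (X : Completion C) : Prop := IsIndObject X.obj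

lemma isInd_yo (A : C) : IsInd ((yo C).obj A) := isIndObject_yoneda A

lemma IsInd.of_iso {X Y : Completion C} (e : X ≅ Y) (h : IsInd X) : IsInd Y :=
  IsIndObject.map ((isContinuous C).ι.mapIso e).hom h

lemma IsInd.of_isColimit {K : J ⥤ Completion C} {c : Cocone K} (hc : IsColimit c)
    (h : ∀ j, IsInd (K.obj j)) : IsInd c.pt := by
  have h' := isColimitOfPreserves (isContinuous C).ι hc
  exact IsIndObject.map ((colimit.isColimit _).coconePointUniqueUpToIso h').hom
    (isIndObject_colimit J (K ⋙ (isContinuous C).ι) h)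

lemma IsInd.exists_presentation {X : Completion C} (h : IsInd X) :
    ∃ (J : Type u) (_ : SmallCategory J) (_ : IsFiltered J) (G : J ⥤ C)
      (ι : G ⋙ yo C ⟶ (Functor.const J).obj X), Nonempty (IsColimit (Cocone.mk X ι)) := by
  let P := h.presentation
  let ι : P.F ⋙ yo C ⟶ (Functor.const P.I).obj X :=
    { app := fun j => ObjectProperty.homMk (P.ι.app j)
      naturality := fun j k φ => by
        ext1
        exact P.ι.naturality φ }
  refine ⟨P.I, inferInstance, inferInstance, P.F, ι, ⟨isColimitOfReflects (isContinuous C).ι ?_⟩⟩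
  exact P.isColimit

/-- Pushouts commute with filtered colimits. -/
lemma exists_isColimit_of_isPushout {E : Type*} [Category* E] {K : J ⥤ E} {S T : E}
    {σ : ∀ j, S ⟶ K.obj j} (hσ : ∀ {j k : J} (φ : j ⟶ k), σ j ≫ K.map φ = σ k) {t : S ⟶ T}
    {Q : J → E} {l : ∀ j, K.obj j ⟶ Q j} {r : ∀ j, T ⟶ Q j}
    (sqQ : ∀ j, IsPushout (σ j) t (l j) (r j)) {c : Cocone K} (hc : IsColimit c) {P : E}
    {a : c.pt ⟶ P} {b : T ⟶ P} (j₀ : J) (sq : IsPushout (σ j₀ ≫ c.ι.app j₀) t a b) :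
    ∃ (L : J ⥤ E) (d : Cocone L), (∀ j, L.obj j = Q j) ∧ d.pt = P ∧ Nonempty (IsColimit d) := by
  -- By filteredness the map from `S` to the colimit is the same through every stage; `j₀` merely
  -- names it.
  have wσ : ∀ j, σ j ≫ c.ι.app j = σ j₀ ≫ c.ι.app j₀ := fun j => by
    rw [← c.w (IsFiltered.leftToMax j j₀), ← c.w (IsFiltered.rightToMax j j₀),
      ← Category.assoc, ← Category.assoc, hσ, hσ]
  have wm : ∀ {j k : J} (φ : j ⟶ k), σ j ≫ K.map φ ≫ l k = t ≫ r k := fun φ => by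
    rw [← Category.assoc, hσ, (sqQ _).w]
  have wd : ∀ j, σ j ≫ c.ι.app j ≫ a = t ≫ b := fun j => by
    rw [← Category.assoc, wσ, sq.w]
  let L : J ⥤ E :=
    { obj := Q
      map := fun {j k} φ => (sqQ j).desc (K.map φ ≫ l k) (r k) (wm φ)
      map_id := fun j => by
        apply (sqQ j).hom_ext
        · rw [IsPushout.inl_desc, K.map_id, Category.id_comp, Category.comp_id]
        · rw [IsPushout.inr_desc, Category.comp_id]
      map_comp := fun {j k m} φ ψ => by
        apply (sqQ j).hom_ext
        · rw [IsPushout.inl_desc, IsPushout.inl_desc_assoc, Category.assoc, IsPushout.inl_desc,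
            K.map_comp, Category.assoc]
        · rw [IsPushout.inr_desc, IsPushout.inr_desc_assoc, IsPushout.inr_desc] }
  have lL : ∀ {j k : J} (φ : j ⟶ k), l j ≫ L.map φ = K.map φ ≫ l k := fun φ =>
    (sqQ _).inl_desc _ _ _
  have rL : ∀ {j k : J} (φ : j ⟶ k), r j ≫ L.map φ = r k := fun φ => (sqQ _).inr_desc _ _ _
  let e : ∀ j, L.obj j ⟶ P := fun j => (sqQ j).desc (c.ι.app j ≫ a) b (wd j)
  have le : ∀ j, l j ≫ e j = c.ι.app j ≫ a := fun j => (sqQ j).inl_desc _ _ _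
  have re : ∀ j, r j ≫ e j = b := fun j => (sqQ j).inr_desc _ _ _
  let d : Cocone L :=
    { pt := P
      ι :=
        { app := e
          naturality := fun j k φ => by
            apply (sqQ j).hom_ext
            · rw [reassoc_of% lL, le, c.w_assoc, reassoc_of% le]
              exact congrArg _ (Category.comp_id _).symm
            · rw [reassoc_of% rL, re, reassoc_of% re]
              exact (Category.comp_id _).symm } }
  have hr : ∀ (s : Cocone L) (j : J), r j ≫ s.ι.app j = r j₀ ≫ s.ι.app j₀ := fun s j => by
    rw [← s.w (IsFiltered.leftToMax j j₀), ← s.w (IsFiltered.rightToMax j j₀),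
      reassoc_of% rL, reassoc_of% rL]
  let cs : ∀ s : Cocone L, Cocone K := fun s =>
    { pt := s.pt
      ι :=
        { app := fun j => l j ≫ s.ι.app j
          naturality := fun j k φ => by
            rw [← s.w φ, reassoc_of% lL]
            exact (Category.comp_id _).symm } }
  have hcs : ∀ (s : Cocone L) (j : J), c.ι.app j ≫ hc.desc (cs s) = l j ≫ s.ι.app j :=
    fun s j => hc.fac _ _
  have ws : ∀ s : Cocone L,
      (σ j₀ ≫ c.ι.app j₀) ≫ hc.desc (cs s) = t ≫ r j₀ ≫ s.ι.app j₀ := fun s => by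
    rw [Category.assoc, hcs, (sqQ j₀).w_assoc]
  refine ⟨L, d, fun _ => rfl, rfl, ⟨
    { desc := fun s => sq.desc (hc.desc (cs s)) (r j₀ ≫ s.ι.app j₀) (ws s)
      fac := fun s j => ?_
      uniq := fun s m hm => ?_ }⟩⟩
  · change e j ≫ _ = _
    apply (sqQ j).hom_ext
    · rw [reassoc_of% le, IsPushout.inl_desc, hcs]
    · rw [reassoc_of% re, IsPushout.inr_desc]
      exact (hr s j).symm
  · have hm' : ∀ j, e j ≫ m = s.ι.app j := hm
    apply sq.hom_ext
    · rw [IsPushout.inl_desc]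
      refine hc.hom_ext fun j => ?_
      rw [hcs, ← hm', reassoc_of% le]
    · rw [IsPushout.inr_desc, ← hm', reassoc_of% re]

lemma IsInd.of_isPushout_of_isColimit {K : J ⥤ Completion C} {S T : Completion C}
    {σ : ∀ j, S ⟶ K.obj j} (hσ : ∀ {j k : J} (φ : j ⟶ k), σ j ≫ K.map φ = σ k) {t : S ⟶ T}
    {c : Cocone K} (hc : IsColimit c) {P : Completion C} {a : c.pt ⟶ P} {b : T ⟶ P} (j₀ : J)
    (sq : IsPushout (σ j₀ ≫ c.ι.app j₀) t a b) (h : ∀ j, IsInd (pushout (σ j) t)) :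
    IsInd P := by
  obtain ⟨L, d, hL, rfl, ⟨hd⟩⟩ := exists_isColimit_of_isPushout hσ
    (fun j => IsPushout.of_hasPushout (σ j) t) hc j₀ sq
  exact .of_isColimit hd fun j => by rw [hL]; exact h j

/-- The attaching map factors through one stage; from there on the cell can be attached stage by
stage inside `C`, and the pushout is the filtered colimit of the results. -/
lemma IsInd.of_isPushout_cof {A B : C} {i : A ⟶ B} (hi : cof i) {X X' : Completion C}
    (hX : IsInd X) {a : (yo C).obj A ⟶ X} {a' : (yo C).obj B ⟶ X'} {g : X ⟶ X'}
    (sq : IsPushout a ((yo C).map i) g a') : IsInd X' := by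
  obtain ⟨J, _, _, G, ι, ⟨hc⟩⟩ := hX.exists_presentation
  obtain ⟨j₀, a₀, rfl⟩ := exists_factor_of_isColimit hc a
  obtain ⟨a₀, rfl⟩ := yo_map_surjective a₀
  -- Passing to the final subdiagram under `j₀` makes the attaching map available at every index.
  have hc' : IsColimit ((Cocone.mk X ι).whisker (Under.forget j₀)) :=
    (Functor.Final.isColimitWhiskerEquiv (Under.forget j₀) _).symm hc
  refine IsInd.of_isPushout_of_isColimit (K := Under.forget j₀ ⋙ G ⋙ yo C)
    (σ := fun k => (yo C).map (a₀ ≫ G.map k.hom)) ?_ hc' (Under.mk (𝟙 j₀))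
    (t := (yo C).map i) (a := g) (b := a') ?_ ?_
  · intro k l φ
    have h : G.map k.hom ≫ G.map φ.right = G.map l.hom := by rw [← G.map_comp, Under.w]
    exact ((yo C).map_comp _ _).symm.trans
      (congrArg (yo C).map ((Category.assoc _ _ _).trans (congrArg (a₀ ≫ ·) h)))
  · have e : (yo C).map (a₀ ≫ G.map (𝟙 j₀)) ≫ ι.app j₀ = (yo C).map a₀ ≫ ι.app j₀ := by
      rw [G.map_id, Category.comp_id]
    exact IsPushout.of_iso sq (Iso.refl _) (Iso.refl _) (Iso.refl _) (Iso.refl _)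
      (by simp) (by simp) (by simp) (by simp)
  · intro k
    obtain ⟨P, l, r, sqP, -⟩ := exists_isPushout i (a₀ ≫ G.map k.hom) hi
    exact (isInd_yo P).of_iso ((yo_isPushout hi sqP).flip.isoPushout)

end FilteredColimits

/-! ### Cofibrant objects as retracts of ind-objects, and lifting for the unit -/

section Cofibrant

variable {C : Type u} [SmallCategory C] [CylinderCategory C]

lemma IsInd.of_isPushout_genCof_pushouts {X Y X' Y' : Completion C} {f : X ⟶ Y}
    (hf : (genCof C).pushouts f) {t : X ⟶ X'} {f' : X' ⟶ Y'} {t' : Y ⟶ Y'}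
    (sq : IsPushout f t t' f') (h : IsInd X') : IsInd Y' := by
  obtain ⟨_, _, _, a, a', ⟨i, hi⟩, sq'⟩ := hf
  exact IsInd.of_isPushout_cof hi h (sq'.paste_horiz sq.flip)

/-- Cobase changes of cell complexes preserve filtered colimits of objects of `C`. -/
lemma IsInd.of_isPushout_cellular {X Y X' Y' : Completion C} {f : X ⟶ Y} (hf : cellular C f)
    {t : X ⟶ X'} {f' : X' ⟶ Y'} {t' : Y ⟶ Y'} (sq : IsPushout f t t' f') (h : IsInd X') :
    IsInd Y' := by
  obtain ⟨J, _, _, _, _, ⟨hJ⟩⟩ := (MorphismProperty.transfiniteCompositions_iff _ _).1 hf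
  let s := hJ.isoBot.hom ≫ t
  have nat : ∀ {j k : J} (φ : j ⟶ k), hJ.F.map (homOfLE bot_le : ⊥ ⟶ j) ≫ hJ.F.map φ =
      hJ.F.map (homOfLE bot_le : ⊥ ⟶ k) := fun φ => by
    rw [← Functor.map_comp]; rfl
  -- Transfinite induction on the stages after cobase change: successors attach one cell, and at
  -- limits the pushout commutes with the colimit.
  have key : ∀ j : J, IsInd (pushout (hJ.F.map (homOfLE bot_le : ⊥ ⟶ j)) s) := by
    intro j
    induction j using SuccOrder.limitRecOn with
    | isMin j hj =>
      obtain rfl := hj.eq_bot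
      have : IsIso (hJ.F.map (homOfLE bot_le : (⊥ : J) ⟶ ⊥)) := by
        rw [show (homOfLE bot_le : (⊥ : J) ⟶ ⊥) = 𝟙 _ from rfl]
        infer_instance
      exact h.of_iso (asIso (pushout.inr (hJ.F.map (homOfLE bot_le : (⊥ : J) ⟶ ⊥)) s))
    | succ j hj hj' =>
      have sq₁ := IsPushout.of_hasPushout (hJ.F.map (homOfLE bot_le : ⊥ ⟶ j)) s
      have sq₂ : IsPushout (hJ.F.map (homOfLE bot_le : ⊥ ⟶ j) ≫
          hJ.F.map (homOfLE (Order.le_succ j))) s (pushout.inl (hJ.F.map (homOfLE bot_le)) s)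
          (pushout.inr (hJ.F.map (homOfLE bot_le : ⊥ ⟶ Order.succ j)) s) := by
        rw [nat]
        exact IsPushout.of_hasPushout _ _
      have sq₃ := sq₂.of_left' sq₁
      exact IsInd.of_isPushout_genCof_pushouts (hJ.map_mem j hj) sq₃ hj'
    | isSuccLimit j hj hj' =>
      have : Nonempty (Set.Iio j) := ⟨⟨⊥, hj.bot_lt⟩⟩
      have hc := hJ.F.isColimitOfIsWellOrderContinuous j hj
      exact IsInd.of_isPushout_of_isColimit (K := (Set.principalSegIio j).monotone.functor ⋙ hJ.F)
        (σ := fun k => hJ.F.map (homOfLE bot_le : ⊥ ⟶ k.1)) (fun φ => nat _) hc ⟨⊥, hj.bot_lt⟩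
        (a := pushout.inl (hJ.F.map (homOfLE bot_le : ⊥ ⟶ j)) s)
        (b := pushout.inr (hJ.F.map (homOfLE bot_le : ⊥ ⟶ j)) s) (t := s)
        (by
          have e : hJ.F.map (homOfLE bot_le : ⊥ ⟶ ⊥) ≫ hJ.F.map (homOfLE bot_le : ⊥ ⟶ j) =
            hJ.F.map (homOfLE bot_le : ⊥ ⟶ j) := nat _
          exact e.symm ▸ IsPushout.of_hasPushout (hJ.F.map (homOfLE bot_le : ⊥ ⟶ j)) s)
        (fun k => hj' k.1 k.2)
  refine IsInd.of_isPushout_of_isColimit (fun φ => nat φ) hJ.isColimit ⊥ (t := s) (a := t')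
    (b := f') ?_ key
  refine IsPushout.of_iso sq hJ.isoBot.symm (Iso.refl _) (Iso.refl _) (Iso.refl _) ?_ ?_ ?_ ?_
  · simp
  · simp [s]
  · simp
  · simp

variable (C) in
lemma yo_isInitial {Z : C} (hZ : IsInitial Z) : Nonempty (IsInitial ((yo C).obj Z)) := by
  have h : ∀ X : Completion C, Nonempty (Unique ((yo C).obj Z ⟶ X)) := fun X => by
    obtain ⟨hX⟩ := X.property.1 Z hZ
    exact ⟨(elt Z X).unique⟩
  exact ⟨IsInitial.ofUnique (h := fun X => (h X).some) _⟩

/-- The cell complex of which `0 ⟶ X` is a retract need not start at `0`. Pushing it out along its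
source's map to `0` corrects this and keeps `X` as a retract. -/
lemma exists_retract_isInd {X : Completion C} (hX : (completionClasses C).IsCofibrant X) :
    ∃ X' : Completion C, IsInd X' ∧ Nonempty (Retract X X') := by
  have := hasInitial (C := C)
  obtain ⟨hZ⟩ := yo_isInitial C (initialIsInitial (C := C))
  obtain ⟨S, T, g, r, hg⟩ := hX _ hZ
  refine ⟨pushout g r.r.left,
    IsInd.of_isPushout_cellular hg (IsPushout.of_hasPushout _ _) (isInd_yo _), ⟨?_⟩⟩
  refine ⟨r.i.right ≫ pushout.inl _ _, pushout.desc r.r.right (hZ.to X) r.r_w.symm, ?_⟩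
  rw [Category.assoc, pushout.inl_desc]
  exact r.retract_right

variable {D : Type u} [SmallCategory D] [CylinderCategory D] {F : C ⥤ D} (hF : IsMorphism F)

lemma IsInd.unitLifting (hff : HomotopyFullyFaithful F) {X : Completion C} (hX : IsInd X) :
    UnitLifting hF X := by
  intro A B i x v hi hxv
  obtain ⟨J, _, _, G, ι, ⟨hc⟩⟩ := hX.exists_presentation
  have : (lanExt F).IsLeftAdjoint := (lanExtAdj hF).isLeftAdjoint
  have hc' := isColimitOfPreserves (lanExt F) hc
  have wι : ∀ {j k : J} (φ : j ⟶ k), (yo C).map (G.map φ) ≫ ι.app k = ι.app j := fun φ =>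
    (ι.naturality φ).trans (Category.comp_id _)
  obtain ⟨j, x, rfl⟩ := exists_factor_of_isColimit hc x
  obtain ⟨k, v, rfl⟩ := exists_factor_of_isColimit hc' v
  obtain ⟨x, rfl⟩ := yo_map_surjective x
  obtain ⟨v, rfl⟩ : ∃ w : F.obj B ⟶ F.obj (G.obj k),
      (yo D).map w ≫ (lanExtYo hF).hom.app (G.obj k) = v := by
    obtain ⟨w, hw⟩ := yo_map_surjective (v ≫ (lanExtYo hF).inv.app (G.obj k))
    refine ⟨w, ?_⟩
    rw [hw]
    exact (Category.assoc _ _ _).trans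
      ((congrArg (v ≫ ·) ((lanExtYo hF).inv_hom_id_app (G.obj k))).trans (Category.comp_id _))
  have e : ((yo D).map v ≫ (lanExtYo hF).hom.app (G.obj k)) ≫ ((lanExt F).mapCocone ⟨X, ι⟩).ι.app k
      = (yo D).map v ≫ applyExt hF (ι.app k) := Category.assoc _ _ _
  -- `F̃` preserves the colimit, so both maps descend to finite stages; moving further along makes
  -- the square commute strictly at a single stage `l`.
  have : ∃ (l : J) (x' : A ⟶ G.obj l) (v' : F.obj B ⟶ F.obj (G.obj l)),
      (yo C).map x ≫ ι.app j = (yo C).map x' ≫ ι.app l ∧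
      (yo D).map v ≫ applyExt hF (ι.app k) = (yo D).map v' ≫ applyExt hF (ι.app l) ∧
      F.map i ≫ v' = F.map x' := by
    have hxv₁ : (yo D).map (F.map i) ≫ (yo D).map v ≫ applyExt hF (ι.app k) =
        (yo D).map (F.map x) ≫ applyExt hF (ι.app j) := by
      rw [← e, hxv, applyExt_map_comp]
    let φ := IsFiltered.leftToMax j k
    let ψ := IsFiltered.rightToMax j k
    have wF : ∀ {j k : J} (φ : j ⟶ k),
        (yo D).map (F.map (G.map φ)) ≫ applyExt hF (ι.app k) = applyExt hF (ι.app j) :=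
      fun φ => by
        rw [← wι φ]
        exact (applyExt_map_comp hF _ _).symm
    have nat : ∀ {m l : J} (χ : m ⟶ l) {T : D} (w : T ⟶ F.obj (G.obj m)),
        ((yo D).map w ≫ (lanExtYo hF).hom.app (G.obj m)) ≫ ((G ⋙ yo C) ⋙ lanExt F).map χ =
        (yo D).map (w ≫ F.map (G.map χ)) ≫ (lanExtYo hF).hom.app (G.obj l) := by
      intro m l χ T w
      have h := (lanExtYo hF).hom.naturality (G.map χ)
      exact (Category.assoc _ _ _).trans ((congrArg ((yo D).map w ≫ ·) h.symm).trans
        ((yo D).map_comp_assoc _ _ _).symm)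
    obtain ⟨l, χ, hχ⟩ := exists_eq_of_isColimit hc' (j := IsFiltered.max j k)
      (v := (yo D).map (F.map i ≫ v ≫ F.map (G.map ψ)) ≫ (lanExtYo hF).hom.app _)
      (w := (yo D).map (F.map (x ≫ G.map φ)) ≫ (lanExtYo hF).hom.app _) (by
        refine (Category.assoc _ _ _).trans (Eq.trans ?_ (Category.assoc _ _ _).symm)
        change (yo D).map (F.map i ≫ v ≫ F.map (G.map ψ)) ≫ applyExt hF (ι.app _) =
          (yo D).map (F.map (x ≫ G.map φ)) ≫ applyExt hF (ι.app _)
        rw [F.map_comp, Functor.map_comp, Functor.map_comp, Functor.map_comp, Category.assoc,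
          Category.assoc, Category.assoc, wF, wF, hxv₁])
    rw [nat, nat] at hχ
    have hχ' := yo_map_injective ((cancel_mono _).1 hχ)
    refine ⟨l, (x ≫ G.map φ) ≫ G.map χ, (v ≫ F.map (G.map ψ)) ≫ F.map (G.map χ), ?_, ?_, ?_⟩
    · rw [Functor.map_comp, Functor.map_comp, Category.assoc, Category.assoc, wι, wι]
    · rw [Functor.map_comp, Functor.map_comp, Category.assoc, Category.assoc, wF, wF]
    · rw [F.map_comp, ← hχ']
      simp only [Category.assoc]
  obtain ⟨l, x', v', hx', hv', hxv'⟩ := this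
  obtain ⟨a, rfl, K, h, h0, h1⟩ := hff i x' v' hi hxv'
  refine ⟨(yo C).map a ≫ ι.app l, ?_, ?_⟩
  · exact ((yo C).map_comp_assoc _ _ _).symm.trans hx'.symm
  · rw [e, hv', applyExt_map_comp]
    refine HomotopicRel.comp ?_ _
    exact homotopicRel_iff.2 ⟨K, (yo D).map h, by
      rw [← Functor.map_comp, ← h0, RelCylinder.in₀, Category.assoc], by
      rw [← Functor.map_comp, ← h1, RelCylinder.in₁, Category.assoc]⟩

end Cofibrant

/-! ### The Quillen pair and the Quillen equivalence -/

section Quillen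

variable {C D : Type u} [SmallCategory C] [SmallCategory D] [CylinderCategory C]
  [CylinderCategory D] {F : C ⥤ D} (hF : IsMorphism F)

lemma unitLifting_of_isCofibrant (hff : HomotopyFullyFaithful F) {X : Completion C}
    (hX : (completionClasses C).IsCofibrant X) : UnitLifting hF X := by
  obtain ⟨X', hX', ⟨r⟩⟩ := exists_retract_isInd hX
  exact UnitLifting.retract hF r (hX'.unitLifting hF hff)

-- `F̃` is a left adjoint, so it preserves retracts, transfinite compositions and pushouts, and it
-- sends a generator `i` to `F i` up to isomorphism.
include hF in
lemma lanExt_map_cof {X Y : Completion C} {f : X ⟶ Y} (hf : (cellular C).retracts f) :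
    (cellular D).retracts ((lanExt F).map f) := by
  obtain ⟨Z, W, g, r, hg⟩ := hf
  refine ⟨_, _, _, r.map (lanExt F), ?_⟩
  have : (lanExt F).IsLeftAdjoint := (lanExtAdj hF).isLeftAdjoint
  obtain ⟨J, _, _, _, _, hJ⟩ := (MorphismProperty.transfiniteCompositions_iff _ _).1 hg
  apply MorphismProperty.transfiniteCompositionsOfShape_le_transfiniteCompositions _ J
  have : PreservesWellOrderContinuousOfShape J (lanExt F) := ⟨fun _ _ => inferInstance⟩
  apply MorphismProperty.transfiniteCompositionsOfShape_map_of_preserves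
  refine MorphismProperty.transfiniteCompositionsOfShape_monotone J ?_ _ hJ
  rintro X Y f ⟨_, _, _, a, b, ⟨i, hi⟩, sq⟩
  refine MorphismProperty.pushouts_mk _ (f := (lanExtYo hF).hom.app _ ≫ (lanExt F).map a)
    (g := (lanExtYo hF).hom.app _ ≫ (lanExt F).map b) ?_ (.mk (F.map i) (hF.map_cof i hi))
  exact IsPushout.of_iso (sq.map (lanExt F)) ((lanExtYo hF).symm.app _) (Iso.refl _)
    ((lanExtYo hF).symm.app _) (Iso.refl _) (by simp)
    ((lanExtYo hF).inv.naturality i) (by simp) (by simp)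

lemma isQuillenPair :
    ModelClasses.IsQuillenPair (completionClasses C) (completionClasses D) (lanExt F)
      (restr hF) where
  map_cof _ hf := lanExt_map_cof hF hf
  map_trivCof f hf := by
    intro X Y g hg
    exact ((lanExtAdj hF).hasLiftingProperty_iff f g).2 (hf _ (restr_map_fib hF hg))
  map_fib _ hf := restr_map_fib hF hf
  map_trivFib _ hf hf' := ⟨restr_map_fib hF hf, restr_map_weq hF hf'⟩

lemma isQuillenEquivalence (h : Acyclic F) :
    ModelClasses.IsQuillenEquivalence (completionClasses C) (completionClasses D)
      (lanExtAdj hF) where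
  isQuillenPair := isQuillenPair hF
  weq_iff {X Y} w hX _ := by
    have hη : completionWeq C ((lanExtAdj hF).unit.app X) := UnitLifting.weq_unit hF (unitLifting_of_isCofibrant hF h.2 hX)
    rw [Adjunction.homEquiv_unit]
    exact ⟨fun hw => completionWeq_comp hη (restr_map_weq hF hw),
      fun hw => weq_of_restr_map_weq hF h (completionWeq_of_comp_left hη hw)⟩

end Quillen

end CylinderCategory

theorem mainTheorem4 {C D : Type u} [SmallCategory C] [SmallCategory D]
    [CylinderCategory C] [CylinderCategory D] (F : C ⥤ D) (hF : CylinderCategory.IsMorphism F) :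
    (∀ (Y : CylinderCategory.Completion D) {A B : C} (i : A ⟶ B) (hi : CylinderCategory.cof i)
      (y : (CylinderCategory.yo D).obj (F.obj A) ⟶ Y),
        Function.Bijective (CylinderCategory.piTranspose hF i hi Y y)) ∧
    (CylinderCategory.HomotopyFullyFaithful F →
      ∀ (X : CylinderCategory.Completion C),
        (CylinderCategory.completionClasses C).IsCofibrant X →
        ∀ {A B : C} (i : A ⟶ B) (hi : CylinderCategory.cof i)
          (x : (CylinderCategory.yo C).obj A ⟶ X),
          Function.Bijective (CylinderCategory.piExt hF i hi X x)) ∧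
    (CylinderCategory.Acyclic F →
      CylinderCategory.ModelClasses.IsQuillenEquivalence (CylinderCategory.completionClasses C)
        (CylinderCategory.completionClasses D) (CylinderCategory.lanExtAdj hF)) :=
  ⟨fun Y _ _ i hi y => CylinderCategory.bijective_piTranspose hF Y i hi y,
    fun hff _ hX _ _ i hi x =>
      CylinderCategory.UnitLifting.bijective_piExt hF
        (CylinderCategory.unitLifting_of_isCofibrant hF hff hX) i hi x,
    fun h => CylinderCategory.isQuillenEquivalence hF h⟩
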